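/- **Setting.** Let $G=(V,E)$ be a finite connected graph with $n$ nodes, maximum degree $\Delta$ and distinct node identifiers in $\mathbb N$; write $N[v]$ for the inclusive neighbourhood of $v$ and $d_G$ for the distance. The graph is a network in the synchronous message passing (LOCAL) model: a node initially knows only its identifier, its private random numbers and the global parameters below (including $n$ and $\Delta$), in each round it sends one message of unbounded size to each neighbour, and local computation is free. A connected dominating set (CDS) is a set $S\subseteq V$ such that every node is in $S$ or has a neighbour in $S$ and $G[S]$ is connected; $\mathrm{CDS}_{OPT}$ is the minimum size of a CDS. **Algorithm.** Fix constants $\alpha>1$, $\varepsilon\in(0,1)$, $\beta\ge 1$, $\lambda\ge 2+\sqrt3$. For an integer $k\ge1$ let $p=n^{-\alpha/k}$, $q=p(1-n p^k)$, and let $\ell\ge \frac{2(1+\beta)}{\varepsilon^2 q}\ln n$ be an integer. *Phase 1 (fractional dominating set).* The LP is: minimize $\sum_{i\in V} x_i$ subject to $\sum_{i\in N[j]}x_i\ge 1$ for all $j\in V$ and $x\ge0$. Let $\mathcal G$ be the graph on $V$ in which $u\ne v$ are adjacent iff the inequalities of $u$ and $v$ are at distance at most $4$ in the bipartite variable-inequality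 graph of the LP. Run $\ell$ independent instances of the Linial–Saks procedure on $\mathcal G$: every node $y$ draws a radius $r_y$ with $\Pr[r_y\ge j]=p^j$ for $0\le j\le k$ and $r_y\le k$; the leader of $v$ is the node $y$ of largest identifier with $d_{\mathcal G}(v,y)\le r_y$; and $v$ joins the cluster of its leader $y$ iff $d_{\mathcal G}(v,y)<r_y$. In each instance and for each cluster, an optimal solution of the LP restricted to the inequalities of the cluster is computed (variables that do not occur are $0$). Let $x$ be the sum of all these solutions. Then every $x_i$ is replaced by $x_i/\min_{j\in N[i]}\sum_{i'\in N[j]}x_{i'}$ (with $0/0=0$). *Phase 2 (randomized rounding).* With $\Delta_p=\Delta+1$: if $x_i\lambda\ln\Delta_p\ge1$, set $x_i'=\lceil x_i\rceil$; otherwise set $x_i'=1$ with probability $x_i\lambda\ln\Delta_p$, independently of everything else, and $x'_i=0$ with the remaining probability. Then, simultaneously for each $j$ with $\sum_{i\in N[j]}x_i'<1$, increase $x_j'$ by the missing amount. Let $D=\{v: x'_v\ge1\}$. *Phase 3 (connecting).* Let $G_D$ be the graph on $D$ in which $u\neq v$ are adjacent iff $d_G(u,v)\le3$. The weight of an edge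 is the ordered pair of the identifiers of its end nodes (smaller one first), compared lexicographically. Remove from $G_D$ every edge that is the heaviest edge of some cycle of $G_D$ of length at most $2k$. For each remaining edge $\{u,v\}$ add to $D$ the nodes of a shortest path from $u$ to $v$ in $G$ (chosen by a fixed rule). The result is $D'$. **Theorem.** There is a constant $C$ depending only on $\alpha,\varepsilon,\beta,\lambda$ such that for all $k$, $\ell$ and $G$ as above: 1. the algorithm runs in at most $Ck$ rounds of the LOCAL model, that is, some LOCAL algorithm with a number of rounds at most $Ck$ (both depending only on the parameters, not otherwise on $G$) outputs exactly $D'$, for every outcome of the random choices; 2. $D'$ is a connected dominating set of $G$, for every outcome of the random choices; 3. if $\Delta\ge 2$, then $$\mathbb E\big[|D'|\big]\ \le\ C\cdot \mathrm{CDS}_{OPT}\cdot n^{C/k}\cdot\ln\Delta .$$ -/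

import Mathlib

namespace DistCDS

/-! ### The synchronous message passing (LOCAL) model -/

/-- A distributed algorithm in the synchronous message passing model. A node starts with its own
identifier and its private random seed (and no knowledge of the network). In every round it sends
one message of unbounded size over each of its ports, receives the messages of its neighbours, and
updates its state by an arbitrary local computation. -/
structure LocalAlg (Seed Out : Type) where
  State : Type
  Msg : Type
  init : ℕ → Seed → State
  send : State → ℕ → Msg
  step : State → (ℕ → Option Msg) → State
  out : State → Out

/-- A port numbering: every node tells its incident communication channels apart by numbers. -/
def IsPortNumbering {V : Type*} (G : SimpleGraph V) (port : V → V → ℕ) : Prop :=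
  ∀ v, Set.InjOn (port v) (G.neighborSet v)

open Classical in
/-- The messages that `v` receives, by port, when `msg u p` is what `u` sends over its port `p`. -/
noncomputable def inbox {V : Type*} {M : Type} (G : SimpleGraph V) (port : V → V → ℕ)
    (msg : V → ℕ → M) (v : V) : ℕ → Option M := fun p =>
  if h : ∃ u, G.Adj v u ∧ port v u = p then some (msg h.choose (port h.choose v)) else none

/-- The state of every node after `t` communication rounds. -/
noncomputable def LocalAlg.stateAt {Seed Out : Type} (A : LocalAlg Seed Out) {V : Type*}
    (G : SimpleGraph V) (ident : V → ℕ) (port : V → V → ℕ) (seed : V → Seed) :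
    ℕ → V → A.State
  | 0 => fun v => A.init (ident v) (seed v)
  | t + 1 => fun v =>
      A.step (A.stateAt G ident port seed t v)
        (inbox G port (fun u => A.send (A.stateAt G ident port seed t u)) v)

open Classical in
/-- The nodes that answer "yes" when all nodes stop after exactly `T` communication rounds. -/
noncomputable def LocalAlg.outputSet {Seed : Type} (A : LocalAlg Seed Bool) {V : Type*} [Fintype V]
    (G : SimpleGraph V) (ident : V → ℕ) (port : V → V → ℕ) (seed : V → Seed) (T : ℕ) : Finset V :=
  Finset.univ.filter fun v => A.out (A.stateAt G ident port seed T v) = true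

/-! ### Connected dominating sets -/

/-- Every node is in `S` or has a neighbour in `S`. -/
def IsDominating {V : Type*} (G : SimpleGraph V) (S : Finset V) : Prop :=
  ∀ v, ∃ u ∈ S, u = v ∨ G.Adj v u

/-- A dominating set that induces a connected subgraph. -/
def IsCDS {V : Type*} (G : SimpleGraph V) (S : Finset V) : Prop :=
  IsDominating G S ∧ (G.induce (S : Set V)).Connected

/-- The size of a smallest connected dominating set. -/
noncomputable def cdsOpt {V : Type*} (G : SimpleGraph V) : ℕ :=
  sInf {m | ∃ S : Finset V, IsCDS G S ∧ S.card = m}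

open Classical in
/-- The inclusive neighbourhood of a node. -/
noncomputable def closedNbr {V : Type*} [Fintype V] (G : SimpleGraph V) (v : V) : Finset V :=
  Finset.univ.filter fun u => u = v ∨ G.Adj v u

theorem closedNbr_nonempty {V : Type*} [Fintype V] (G : SimpleGraph V) (v : V) :
    (closedNbr G v).Nonempty :=
  ⟨v, by simp [closedNbr]⟩

/-! ### Phase 1: the fractional dominating set

The linear program is: minimize `∑ i, x i` subject to `∑ i ∈ closedNbr G j, x i ≥ 1` for every
node `j`, and `x ≥ 0`. -/

/-- The network graph of the linear program: `inl i` is the primal node of the variable `x i`,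
`inr j` is the dual node of the inequality of `j`. -/
def lpGraph {V : Type*} (G : SimpleGraph V) : SimpleGraph (V ⊕ V) where
  Adj
    | .inl i, .inr j => i = j ∨ G.Adj i j
    | .inr j, .inl i => i = j ∨ G.Adj i j
    | _, _ => False
  symm := ⟨by
    rintro (a | a) (b | b) h
    · exact h
    · exact h
    · exact h
    · exact h⟩
  loopless := ⟨by rintro (a | a) h <;> exact h⟩

/-- The graph on the dual nodes on which the network decomposition is run. -/
def lsGraph {V : Type*} (G : SimpleGraph V) : SimpleGraph V where
  Adj u v := u ≠ v ∧ (lpGraph G).edist (.inr u) (.inr v) ≤ 4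
  symm := ⟨fun u v h => ⟨h.1.symm, by rw [SimpleGraph.edist_comm]; exact h.2⟩⟩
  loopless := ⟨fun _ h => h.1 rfl⟩

open Classical in
/-- The radius that a node draws from a uniform `u ∈ [0, 1]`, with `p = n ^ (-α / R)`: it is at
least `j` iff `u ≤ p ^ j`, for `j ≤ R`. So it has the geometric distribution with parameter `p`
truncated at `R`: it is `j < R` with probability `p ^ j * (1 - p)`, and `R` with probability
`p ^ R`. -/
noncomputable def radius (n R : ℕ) (α : ℝ) (u : unitInterval) : ℕ :=
  Nat.findGreatest (fun j => (u : ℝ) ≤ ((n : ℝ) ^ (-α / (R : ℝ))) ^ j) R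

/-- Linial-Saks: `y` is the leader of `v` if it has the largest identifier among the nodes within
whose radius `v` lies. -/
def IsLeader {V : Type*} (H : SimpleGraph V) (ident : V → ℕ) (r : V → ℕ) (y v : V) : Prop :=
  H.edist v y ≤ r y ∧ ∀ z, H.edist v z ≤ r z → ident z ≤ ident y

open Classical in
/-- Linial-Saks: the nodes that join the computed set with leader `y`, namely those that lie
strictly within the radius of their leader `y`. -/
noncomputable def lsCluster {V : Type*} [Fintype V] (H : SimpleGraph V) (ident : V → ℕ)
    (r : V → ℕ) (y : V) : Finset V :=
  Finset.univ.filter fun v => IsLeader H ident r y v ∧ H.edist v y < r y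

/-- `x` is feasible for the covering LP with one inequality `∑ i ∈ A, x i ≥ 1` for each `A ∈ F`.
Variables that do not occur are `0`. -/
def IsFracCover (F : Finset (Finset ℕ)) (x : ℕ → ℝ) : Prop :=
  (∀ i, 0 ≤ x i) ∧ (∀ i, i ∉ F.biUnion id → x i = 0) ∧ ∀ A ∈ F, 1 ≤ ∑ i ∈ A, x i

/-- `x` is an optimal solution of that covering LP. -/
def IsOptFracCover (F : Finset (Finset ℕ)) (x : ℕ → ℝ) : Prop :=
  IsFracCover F x ∧
    ∀ y, IsFracCover F y → ∑ i ∈ F.biUnion id, x i ≤ ∑ i ∈ F.biUnion id, y i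

/-- The optimal solution that a leader computes; it depends on the local LP only, whose variables
are named by the identifiers of the nodes. -/
noncomputable def lpSolution (F : Finset (Finset ℕ)) : ℕ → ℝ :=
  Classical.epsilon (IsOptFracCover F)

open Classical in
/-- The local LP of a cluster: the inequalities of the nodes of the cluster. -/
noncomputable def clusterLP {V : Type*} [Fintype V] (G : SimpleGraph V) (ident : V → ℕ)
    (K : Finset V) : Finset (Finset ℕ) :=
  K.image fun j => (closedNbr G j).image ident

/-- The sum, over the `ℓ` instances of the decomposition, of the solutions of the local LPs. No two
clusters of the same instance share a variable. -/
noncomputable def lpSum {V : Type*} [Fintype V] (G : SimpleGraph V) (ident : V → ℕ) {ℓ : ℕ}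
    (r : Fin ℓ → V → ℕ) (i : V) : ℝ :=
  ∑ t, ∑ y, lpSolution (clusterLP G ident (lsCluster (lsGraph G) ident (r t) y)) (ident i)

/-- The output of the distributed LP algorithm: `x i` is divided by the smallest left-hand side of
an inequality in which it occurs (if that is `0`, then `x i = 0`, and it stays `0`). -/
noncomputable def fracDS {V : Type*} [Fintype V] (G : SimpleGraph V) (ident : V → ℕ) {ℓ : ℕ}
    (r : Fin ℓ → V → ℕ) (i : V) : ℝ :=
  lpSum G ident r i /
    (closedNbr G i).inf' (closedNbr_nonempty G i)
      (fun j => ∑ i' ∈ closedNbr G j, lpSum G ident r i')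

/-! ### Phase 2: randomized rounding

The maximum primal degree of the LP is `Δ + 1`, as a node occurs in its own inequality. -/

open Classical in
/-- The rounded variable, from a uniform `coin ∈ [0, 1]`. The first case is
`x ≥ 1 / (lam * log (Δ + 1))`. -/
noncomputable def roundVar (Δ : ℕ) (lam x : ℝ) (coin : unitInterval) : ℕ :=
  if 1 ≤ x * (lam * Real.log ((Δ : ℝ) + 1)) then ⌈x⌉₊
  else if (coin : ℝ) < x * (lam * Real.log ((Δ : ℝ) + 1)) then 1 else 0

/-- The integer solution: the missing weight of the inequality of `v` (which is `0` if it is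
satisfied) is added to one variable of minimum cost in it. All costs are `1`; `v` takes its own. -/
noncomputable def intDS {V : Type*} [Fintype V] (G : SimpleGraph V) (Δ : ℕ) (lam : ℝ)
    (x : V → ℝ) (coin : V → unitInterval) (v : V) : ℕ :=
  roundVar Δ lam (x v) (coin v) + (1 - ∑ u ∈ closedNbr G v, roundVar Δ lam (x u) (coin u))

open Classical in
/-- The dominating set given by the integer solution. -/
noncomputable def roundedDS {V : Type*} [Fintype V] (G : SimpleGraph V) (Δ : ℕ) (lam : ℝ)
    (x : V → ℝ) (coin : V → unitInterval) : Finset V :=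
  Finset.univ.filter fun v => 1 ≤ intDS G Δ lam x coin v

/-! ### Phase 3: connecting the dominating set -/

/-- The graph `G_D` on the nodes of `D`: two of them are adjacent iff their distance in `G` is at
most `3`. -/
def domGraph {V : Type*} (G : SimpleGraph V) (D : Finset V) : SimpleGraph {v // v ∈ D} where
  Adj u v := u ≠ v ∧ G.edist u.1 v.1 ≤ 3
  symm := ⟨fun u v h => ⟨h.1.symm, by rw [SimpleGraph.edist_comm]; exact h.2⟩⟩
  loopless := ⟨fun _ h => h.1 rfl⟩

/-- The weight of an edge: the ordered pair of the identifiers of its end nodes, compared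
lexicographically. -/
def edgeWeight {W : Type*} (ident : W → ℕ) (e : Sym2 W) : ℕ ×ₗ ℕ :=
  toLex ((e.map ident).inf, (e.map ident).sup)

/-- Remove every edge that has the largest weight in some cycle of length at most `2 * k`. -/
def sparsify {W : Type*} (H : SimpleGraph W) (ident : W → ℕ) (k : ℕ) : SimpleGraph W :=
  H.deleteEdges {e | ∃ (a : W) (c : H.Walk a a), c.IsCycle ∧ c.length ≤ 2 * k ∧ e ∈ c.edges ∧
    ∀ f ∈ c.edges, edgeWeight ident f ≤ edgeWeight ident e}

/-- A shortest path from `u` to `v` in `G`, as a list of identifiers; the choice depends only on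
the set of all such lists. -/
noncomputable def shortestPath {V : Type*} (G : SimpleGraph V) (ident : V → ℕ) (u v : V) :
    List ℕ :=
  Classical.epsilon fun L =>
    ∃ w : G.Walk u v, w.length = G.dist u v ∧ L = w.support.map ident

open Classical in
/-- `D` together with the nodes of one shortest path in `G` for each edge of the sparse spanning
subgraph of `G_D`. -/
noncomputable def connectDS {V : Type*} [Fintype V] (G : SimpleGraph V) (ident : V → ℕ) (k : ℕ)
    (D : Finset V) : Finset V :=
  D ∪ Finset.univ.filter fun x => ∃ u v : {v // v ∈ D},
    (sparsify (domGraph G D) (fun w => ident w.1) k).Adj u v ∧ ident u.1 < ident v.1 ∧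
      ident x ∈ shortestPath G ident u.1 v.1

/-! ### The complete algorithm -/

/-- The private randomness of a node: independent uniform numbers in `[0, 1]`, one for each of the
`ℓ` instances of the network decomposition, and one for the rounding. -/
abbrev Seed (ℓ : ℕ) : Type := (Fin ℓ → unitInterval) × unitInterval

/-- The result of the three phases, on a graph with `n` nodes and maximum degree `Δ`, for the
outcome `ω` of the random choices. -/
noncomputable def mcds {V : Type*} [Fintype V] (G : SimpleGraph V) (ident : V → ℕ)
    (n Δ k ℓ : ℕ) (α lam : ℝ) (ω : V → Seed ℓ) : Finset V :=
  connectDS G ident k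
    (roundedDS G Δ lam
      (fracDS G ident fun (t : Fin ℓ) v => radius n k α ((ω v).1 t))
      (fun v => (ω v).2))

end DistCDS

/-!
The three claims are proved separately, with the round count `22 * k`.

*Rounds.* What a node can know after `T` rounds is its view (`Net.view`): the tree of identifiers
and seeds that unfolds around it. An algorithm that collects views (`viewAlg`) outputs any set
whose membership is determined by the view after `T` rounds (`viewAlg_outputSet`), so it is enough
to show that membership in the result is a local quantity in the sense of `IsLocal`. This is done
phase by phase, with `IsLocal.transfer` as the tool that moves nodes between networks with equal
views. One step in the graph on which the clustering runs is at most four steps in `G`, so clusters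
have radius less than `4 * k` (`isLocal_lpSum`). Whether an edge survives the sparsification is
decided by the lighter walks between its ends (`sparsify_adj_iff`), which stay within distance
`O(k)` (`isLocal_lightReach`).

*Connectivity.* After the rounding every violated inequality is repaired by its own node, so `D` is
dominating in every outcome (`isDominating_roundedDS`). Then `G_D` is connected, as dominators of
adjacent nodes are at distance at most `3` (`domGraph_connected`); the ends of a removed edge are
joined by lighter edges, so induction on the weight shows that the sparse graph is connected
(`sparsify_connected`); and replacing its edges by shortest paths of `G` keeps this
(`isCDS_connectDS`).

*Size.* The sparse graph has no cycle of length at most `2 * k`, so by the Moore bound it has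
`O(n ^ (1 / k) * |D|)` edges (`pow_le_card_layer`, `card_connectDS_le`), and it remains to bound the
expectation of `|D|`. A Linial–Saks instance clusters a given node with probability at least `q`
(`le_volume_clustered`). By Chernoff's bound (`volume_few_successes_le`) and the choice of `ℓ`, all
nodes are clustered in at least `(1 - ε) * q * ℓ` instances, outside an event that is too rare to
matter. Clusters of one instance share no variable (`lsCluster_eq`), so their local optima together
cost at most the size of any dominating set (`sum_lpSolution_le`). Hence the sum over the instances
is at most `ℓ` times the optimum, and the rescaling divides it by at least `(1 - ε) * q * ℓ`, where
`q` is of order `n ^ (-α / k)` (`success_probability_bounds`). Rounding costs a factor of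
`lam * log (Δ + 1)` and leaves an inequality violated with probability at most `1 / (Δ + 1)`
(`integral_card_roundedDS_le`); the repair is paid for by `n ≤ (Δ + 1) * |S|` for dominating `S`
(`card_le_mul_of_isDominating`). The bounds are combined in `integral_card_mcds_le_cdsOpt`.
-/

namespace DistCDS

/-! ### Locality -/

universe u

theorem edist_le_iff_exists_walk {V : Type*} (G : SimpleGraph V) (a b : V) (c : ℕ) :
    G.edist a b ≤ (c : ℕ∞) ↔ ∃ w : G.Walk a b, w.length ≤ c := by
  constructor
  · intro h
    obtain ⟨w, hw⟩ := SimpleGraph.exists_walk_of_edist_ne_top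
      (ne_top_of_le_ne_top (ENat.natCast_ne_top c) h)
    exact ⟨w, by rw [← hw] at h; exact_mod_cast h⟩
  · rintro ⟨w, hw⟩
    exact w.edist_le.trans (by exact_mod_cast hw)

theorem mem_closedNbr_iff {V : Type*} [Fintype V] {G : SimpleGraph V} {u v : V} :
    u ∈ closedNbr G v ↔ G.edist v u ≤ ((1 : ℕ) : ℕ∞) := by
  simp only [closedNbr, Finset.mem_filter, Finset.mem_univ, true_and]
  rw [edist_le_iff_exists_walk]
  constructor
  · rintro (rfl | h)
    · exact ⟨.nil, by simp⟩
    · exact ⟨.cons h .nil, by simp⟩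
  · rintro ⟨w, hw⟩
    cases w with
    | nil => exact .inl rfl
    | cons h w =>
      cases w with
      | nil => exact .inr h
      | cons h' w => simp at hw

theorem edist_triangle_nat {V : Type*} {G : SimpleGraph V} {a b c : V} {m n r : ℕ}
    (h₁ : G.edist a b ≤ (m : ℕ∞)) (h₂ : G.edist b c ≤ (n : ℕ∞)) (h : m + n ≤ r) :
    G.edist a c ≤ (r : ℕ∞) :=
  (SimpleGraph.edist_triangle (v := b)).trans ((add_le_add h₁ h₂).trans (by exact_mod_cast h))

theorem edist_comm_le {V : Type*} {G : SimpleGraph V} {a b : V} {m : ℕ∞}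
    (h : G.edist a b ≤ m) : G.edist b a ≤ m := by
  rwa [SimpleGraph.edist_comm]

/-- A network whose nodes carry distinct identifiers and private random seeds in `S`. -/
structure Net (S : Type) where
  V : Type u
  [fin : Fintype V]
  G : SimpleGraph V
  ident : V → ℕ
  inj : Function.Injective ident
  seed : V → S

attribute [instance] Net.fin

/-- The type of what a node can know after `t` rounds: initially its identifier and its seed, then
its previous view together with the set of the previous views of its neighbours. -/
def View (S : Type) : ℕ → Type
  | 0 => ℕ × S
  | t + 1 => View S t × Set (View S t)

/-- The view of a node after `t` rounds. -/
def Net.view {S : Type} (N : Net.{u} S) : (t : ℕ) → N.V → View S t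
  | 0 => fun v => (N.ident v, N.seed v)
  | t + 1 => fun v => (N.view t v, {w | ∃ u, N.G.Adj v u ∧ N.view t u = w})

/-- A quantity attached to the nodes of all networks is `T`-local if the view of a node after `T`
rounds determines it. -/
def IsLocal {S : Type} (T : ℕ) {X : Type*} (F : ∀ N : Net.{u} S, N.V → X) : Prop :=
  ∀ (N N' : Net.{u} S) (v : N.V) (v' : N'.V), N.view T v = N'.view T v' → F N v = F N' v'

section calculus

variable {S : Type} {X Y : Type*} {N N' : Net.{u} S} {v : N.V} {v' : N'.V}

theorem view_eq_mono {s t : ℕ} (hst : s ≤ t) (h : N.view t v = N'.view t v') :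
    N.view s v = N'.view s v' := by
  induction hst with
  | refl => exact h
  | step _ ih => exact ih (congrArg Prod.fst h)

/-- Equal views after `s + c` rounds: every node within distance `c` of one centre has a
counterpart, with the same view after `s` rounds, within distance `c` of the other centre. -/
theorem exists_view_eq {s c : ℕ} (h : N.view (s + c) v = N'.view (s + c) v') {u : N.V}
    (hu : N.G.edist v u ≤ (c : ℕ∞)) :
    ∃ u' : N'.V, N'.G.edist v' u' ≤ (c : ℕ∞) ∧ N.view s u = N'.view s u' := by
  obtain ⟨w, hw⟩ := (edist_le_iff_exists_walk _ _ _ _).1 hu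
  induction c generalizing v v' with
  | zero =>
    cases w with
    | nil => exact ⟨v', by simp, h⟩
    | cons => simp at hw
  | succ c ih =>
    cases w with
    | nil => exact ⟨v', by simp, view_eq_mono (by omega) h⟩
    | @cons _ x _ hx w =>
      have h2 : {w | ∃ u, N.G.Adj v u ∧ N.view (s + c) u = w} =
        {w | ∃ u, N'.G.Adj v' u ∧ N'.view (s + c) u = w} := congrArg Prod.snd h
      obtain ⟨x', hx', he⟩ := (Set.ext_iff.1 h2 (N.view (s + c) x)).1 ⟨x, hx, rfl⟩
      have hw' : w.length ≤ c := by simpa using hw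
      obtain ⟨u', h1, h2⟩ := ih he.symm ((edist_le_iff_exists_walk _ _ _ _).2 ⟨w, hw'⟩) w hw'
      refine ⟨u', ?_, h2⟩
      exact edist_triangle_nat (m := 1) (n := c)
        ((edist_le_iff_exists_walk _ _ _ _).2 ⟨.cons hx' .nil, by simp⟩) h1 (by omega)

/-- The form in which locality is used: a node within distance `c` of one centre has a counterpart
around the other one at which an `s`-local quantity takes the same value. -/
theorem IsLocal.transfer {s c T : ℕ} {F : ∀ N : Net.{u} S, N.V → X} (hF : IsLocal s F)
    (h : N.view T v = N'.view T v') (hT : s + c ≤ T) {u : N.V}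
    (hu : N.G.edist v u ≤ (c : ℕ∞)) :
    ∃ u' : N'.V, N'.G.edist v' u' ≤ (c : ℕ∞) ∧ F N u = F N' u' := by
  obtain ⟨u', h1, h2⟩ := exists_view_eq (view_eq_mono hT h) hu
  exact ⟨u', h1, hF _ _ _ _ h2⟩

theorem IsLocal.mono {s t : ℕ} {F : ∀ N : Net.{u} S, N.V → X} (hF : IsLocal s F) (h : s ≤ t) :
    IsLocal t F := fun N N' v v' hv => hF N N' v v' (view_eq_mono h hv)

theorem IsLocal.prod {t : ℕ} {F : ∀ N : Net.{u} S, N.V → X} {F' : ∀ N : Net.{u} S, N.V → Y}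
    (hF : IsLocal t F) (hF' : IsLocal t F') : IsLocal t fun N v => (F N v, F' N v) :=
  fun N N' v v' h => Prod.ext (hF N N' v v' h) (hF' N N' v v' h)

theorem IsLocal.comp {t : ℕ} {F : ∀ N : Net.{u} S, N.V → X} (hF : IsLocal t F) (g : X → Y) :
    IsLocal t fun N v => g (F N v) :=
  fun N N' v v' h => congrArg g (hF N N' v v' h)

theorem IsLocal.of_le [PartialOrder X] {t : ℕ} {F : ∀ N : Net.{u} S, N.V → X}
    (hF : ∀ (N N' : Net.{u} S) (v : N.V) (v' : N'.V), N.view t v = N'.view t v' →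
      F N v ≤ F N' v') : IsLocal t F :=
  fun N N' v v' h => le_antisymm (hF N N' v v' h) (hF N' N v' v h.symm)

theorem isLocal_ident : IsLocal 0 fun (N : Net.{u} S) v => N.ident v :=
  fun _ _ _ _ h => congrArg Prod.fst h

theorem isLocal_seed : IsLocal 0 fun (N : Net.{u} S) v => N.seed v :=
  fun _ _ _ _ h => congrArg Prod.snd h

/-- With equal views, the nodes that share an identifier lie at the same distance from the
centres, up to the radius of the views. -/
theorem edist_le_of_view_eq {c T : ℕ} (h : N.view T v = N'.view T v') (hT : c ≤ T) {u : N.V}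
    {u' : N'.V} (hid : N.ident u = N'.ident u') (hu : N.G.edist v u ≤ (c : ℕ∞)) :
    N'.G.edist v' u' ≤ (c : ℕ∞) := by
  obtain ⟨x, h1, h2⟩ := isLocal_ident.transfer h (by omega : 0 + c ≤ T) hu
  rwa [N'.inj (hid.symm.trans h2)]

theorem IsLocal.image_closedNbr [DecidableEq X] {t : ℕ} {F : ∀ N : Net.{u} S, N.V → X}
    (hF : IsLocal t F) : IsLocal (t + 1) fun N v => (closedNbr N.G v).image (F N) := by
  refine IsLocal.of_le fun N N' v v' h x hx => ?_
  obtain ⟨y, hy, rfl⟩ := Finset.mem_image.1 hx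
  obtain ⟨y', hy', he⟩ := hF.transfer h le_rfl (mem_closedNbr_iff.1 hy)
  exact Finset.mem_image.2 ⟨y', mem_closedNbr_iff.2 hy', he.symm⟩

theorem IsLocal.sum_closedNbr {M : Type*} [AddCommMonoid M] {t : ℕ}
    {F : ∀ N : Net.{u} S, N.V → M} (hF : IsLocal t F) :
    IsLocal (t + 1) fun N v => ∑ x ∈ closedNbr N.G v, F N x := by
  classical
  -- the identifiers keep equal summands apart
  have h := (((isLocal_ident.mono (Nat.zero_le t)).prod hF).image_closedNbr).comp
    fun s => ∑ p ∈ s, p.2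
  have key : ∀ (N : Net.{u} S) (v : N.V),
      ∑ p ∈ (closedNbr N.G v).image (fun x => (N.ident x, F N x)), p.2 =
        ∑ x ∈ closedNbr N.G v, F N x := fun N v =>
    Finset.sum_image fun a _ b _ hab => N.inj (congrArg Prod.fst hab)
  intro N N' v v' hv
  exact (key N v).symm.trans ((h N N' v v' hv).trans (key N' v'))

theorem IsLocal.inf'_closedNbr {t : ℕ} {F : ∀ N : Net.{u} S, N.V → ℝ} (hF : IsLocal t F) :
    IsLocal (t + 1) fun N v =>
      (closedNbr N.G v).inf' (closedNbr_nonempty N.G v) (F N) := by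
  refine IsLocal.of_le fun N N' v v' h => Finset.le_inf' _ _ fun x hx => ?_
  obtain ⟨y, hy, he⟩ := hF.transfer h.symm le_rfl (mem_closedNbr_iff.1 hx)
  rw [he]
  exact Finset.inf'_le _ (mem_closedNbr_iff.2 hy)

end calculus

/-! ### The algorithm that collects views -/

/-- Every node repeatedly sends its view to its neighbours; after `T` rounds it answers "yes" if
some network has a node with the same view that belongs to the target set. -/
noncomputable def viewAlg (S : Type) (T : ℕ) (P : ∀ N : Net.{u} S, N.V → Prop) :
    LocalAlg S Bool where
  State := Σ t, View S t
  Msg := Σ t, View S t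
  init := fun i s => ⟨0, (i, s)⟩
  send := fun s _ => s
  step := fun s inb => ⟨s.1 + 1, (s.2, {m | ∃ p, inb p = some ⟨s.1, m⟩})⟩
  out := fun s =>
    haveI := Classical.dec (∃ (N : Net.{u} S) (v : N.V), s = ⟨T, N.view T v⟩ ∧ P N v)
    decide (∃ (N : Net.{u} S) (v : N.V), s = ⟨T, N.view T v⟩ ∧ P N v)

/-- As ports tell the neighbours apart, the messages received in round `t + 1` are exactly the views
of the neighbours after `t` rounds. -/
theorem viewAlg_stateAt {S : Type} (T : ℕ) (P : ∀ N : Net.{u} S, N.V → Prop) (N : Net.{u} S)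
    (port : N.V → N.V → ℕ) (hport : IsPortNumbering N.G port) (t : ℕ) (v : N.V) :
    (viewAlg S T P).stateAt N.G N.ident port N.seed t v = ⟨t, N.view t v⟩ := by
  induction t generalizing v with
  | zero => rfl
  | succ t ih =>
    simp only [LocalAlg.stateAt, ih]
    change (⟨t + 1, (N.view t v, _)⟩ : Σ t, View S t) = _
    congr 2
    ext m
    simp only [inbox, Set.mem_ofPred_eq]
    constructor
    · rintro ⟨p, hp⟩
      split_ifs at hp with h
      refine ⟨h.choose, h.choose_spec.1, ?_⟩
      have := Option.some.inj hp
      simpa [viewAlg] using this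
    · rintro ⟨x, hx, rfl⟩
      refine ⟨port v x, ?_⟩
      have h : ∃ u, N.G.Adj v u ∧ port v u = port v x := ⟨x, hx, rfl⟩
      rw [dif_pos h]
      have : h.choose = x := hport v h.choose_spec.1 hx h.choose_spec.2
      simp [viewAlg, this]

open Classical in
/-- A `T`-local set of nodes is computed in `T` rounds, since nodes with equal views agree on
membership, in whatever networks they lie. -/
theorem viewAlg_outputSet {S : Type} (T : ℕ) {P : ∀ N : Net.{u} S, N.V → Prop}
    (hP : IsLocal T P) (N : Net.{u} S)
    (port : N.V → N.V → ℕ) (hport : IsPortNumbering N.G port) :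
    (viewAlg S T P).outputSet N.G N.ident port N.seed T = Finset.univ.filter (P N) := by
  ext v
  simp only [LocalAlg.outputSet, Finset.mem_filter, Finset.mem_univ, true_and,
    viewAlg_stateAt T P N port hport]
  simp only [viewAlg, decide_eq_true_eq]
  constructor
  · rintro ⟨N', v', h, hp⟩
    have h' : N.view T v = N'.view T v' := by simpa using h
    rwa [hP N N' v v' h']
  · intro h
    exact ⟨N, v, rfl, h⟩

/-! ### Distances in the auxiliary graphs -/

theorem edist_le_add_iff {V : Type*} (G : SimpleGraph V) (a b : V) (m n : ℕ) :
    G.edist a b ≤ ((m + n : ℕ) : ℕ∞) ↔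
      ∃ x, G.edist a x ≤ (m : ℕ∞) ∧ G.edist x b ≤ (n : ℕ∞) := by
  constructor
  · intro h
    obtain ⟨w, hw⟩ := (edist_le_iff_exists_walk _ _ _ _).1 h
    refine ⟨w.getVert m, (edist_le_iff_exists_walk _ _ _ _).2 ⟨w.take m, ?_⟩,
      (edist_le_iff_exists_walk _ _ _ _).2 ⟨w.drop m, ?_⟩⟩
    · rw [SimpleGraph.Walk.take_length]
      exact min_le_left _ _
    · rw [SimpleGraph.Walk.drop_length]
      omega
  · rintro ⟨x, h₁, h₂⟩
    exact edist_triangle_nat h₁ h₂ le_rfl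

theorem edist_le_one_iff {V : Type*} {G : SimpleGraph V} {a b : V} :
    G.edist a b ≤ ((1 : ℕ) : ℕ∞) ↔ a = b ∨ G.Adj a b := by
  rw [Nat.cast_one, SimpleGraph.edist_le_one_iff_adj_or_eq]
  tauto

theorem edist_le_of_lpGraph_walk {V : Type*} {G : SimpleGraph V} {a b : V ⊕ V}
    (w : (lpGraph G).Walk a b) :
    G.edist (Sum.elim id id a) (Sum.elim id id b) ≤ (w.length : ℕ∞) := by
  induction w with
  | nil => simp
  | @cons a c b h w ih =>
    refine edist_triangle_nat (m := 1) ?_ ih (by simp [add_comm])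
    rw [edist_le_one_iff]
    rcases a with a | a <;> rcases c with c | c
    · exact h.elim
    · exact h
    · exact h.imp Eq.symm SimpleGraph.Adj.symm
    · exact h.elim

theorem lsGraph_adj_iff {V : Type*} {G : SimpleGraph V} {u v : V} :
    (lsGraph G).Adj u v ↔ u ≠ v ∧ G.edist u v ≤ ((4 : ℕ) : ℕ∞) := by
  refine and_congr_right fun _ => ⟨fun h => ?_, fun h => ?_⟩
  · obtain ⟨w, hw⟩ := (edist_le_iff_exists_walk (lpGraph G) (.inr u) (.inr v) 4).1 h
    exact (edist_le_of_lpGraph_walk w).trans (by exact_mod_cast hw)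
  · obtain ⟨b, hb, h⟩ := (edist_le_add_iff G u v 1 3).1 h
    obtain ⟨c, hc, h⟩ := (edist_le_add_iff G b v 1 2).1 h
    obtain ⟨d, hd, h⟩ := (edist_le_add_iff G c v 1 1).1 h
    rw [edist_le_one_iff] at hb hc hd h
    have h1 : (lpGraph G).Adj (.inr u) (.inl b) := hb.imp Eq.symm SimpleGraph.Adj.symm
    have h2 : (lpGraph G).Adj (.inl b) (.inr c) := hc
    have h3 : (lpGraph G).Adj (.inr c) (.inl d) := hd.imp Eq.symm SimpleGraph.Adj.symm
    have h4 : (lpGraph G).Adj (.inl d) (.inr v) := h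
    exact (edist_le_iff_exists_walk (lpGraph G) (.inr u) (.inr v) 4).2
      ⟨.cons h1 (.cons h2 (.cons h3 (.cons h4 .nil))), by simp⟩

theorem lsGraph_edist_le_iff {V : Type*} {G : SimpleGraph V} {u v : V} {m : ℕ} :
    (lsGraph G).edist u v ≤ (m : ℕ∞) ↔ G.edist u v ≤ ((4 * m : ℕ) : ℕ∞) := by
  constructor
  · intro h
    obtain ⟨w, hw⟩ := (edist_le_iff_exists_walk _ _ _ _).1 h
    clear h
    induction w generalizing m with
    | nil => simp
    | @cons a c b h w ih =>
      rw [SimpleGraph.Walk.length_cons] at hw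
      exact edist_triangle_nat (lsGraph_adj_iff.1 h).2 (ih (m := m - 1) (by omega)) (by omega)
  · intro h
    induction m generalizing u with
    | zero =>
      have : u = v := by simpa using h
      simp [this]
    | succ m ih =>
      obtain ⟨x, hx, h⟩ := (edist_le_add_iff G u v 4 (4 * m)).1
        (by rwa [show 4 + 4 * m = 4 * (m + 1) by ring])
      by_cases hux : u = x
      · subst hux
        exact (ih h).trans (by exact_mod_cast Nat.le_succ m)
      · exact edist_triangle_nat (m := 1)
          (edist_le_one_iff.2 (.inr (lsGraph_adj_iff.2 ⟨hux, hx⟩))) (ih h) (by omega)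

theorem mem_lsCluster_iff {V : Type*} [Fintype V] {H : SimpleGraph V} {ident : V → ℕ}
    {r : V → ℕ} {y v : V} :
    v ∈ lsCluster H ident r y ↔ IsLeader H ident r y v ∧ H.edist v y < r y := by
  simp [lsCluster]

theorem edist_lt_nat_iff {V : Type*} {H : SimpleGraph V} {v y : V} {c : ℕ} :
    H.edist v y < (c : ℕ∞) ↔ 1 ≤ c ∧ H.edist v y ≤ ((c - 1 : ℕ) : ℕ∞) := by
  cases c with
  | zero => simp
  | succ c =>
    simp only [Nat.le_add_left, true_and, Nat.add_sub_cancel]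
    rw [Nat.cast_succ, ENat.lt_add_one_iff (ENat.natCast_ne_top c)]

/-! ### Fractional covers -/

/-- Truncating a fractional cover at `1` leaves it a fractional cover. -/
theorem IsFracCover.truncate {F : Finset (Finset ℕ)} {y : ℕ → ℝ} (hy : IsFracCover F y) :
    IsFracCover F fun i => min (y i) 1 := by
  refine ⟨fun i => le_min (hy.1 i) zero_le_one, fun i hi => by simp [hy.2.1 i hi],
    fun A hA => ?_⟩
  by_cases h : ∃ i ∈ A, 1 ≤ y i
  · obtain ⟨i, hi, h⟩ := h
    calc (1 : ℝ) = min (y i) 1 := (min_eq_right h).symm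
      _ ≤ _ := Finset.single_le_sum (f := fun i => min (y i) 1)
        (fun j _ => le_min (hy.1 j) zero_le_one) hi
  · push Not at h
    rw [Finset.sum_congr rfl fun i hi => min_eq_left (h i hi).le]
    exact hy.2.2 A hA

/-- After truncation at `1` the feasible solutions form a compact set. -/
theorem exists_isOptFracCover (F : Finset (Finset ℕ)) (hF : ∀ A ∈ F, A.Nonempty) :
    ∃ x, IsOptFracCover F x := by
  classical
  set U := F.biUnion id
  let K : Set (ℕ → ℝ) := (Set.univ.pi fun i => Set.Icc (0 : ℝ) (if i ∈ U then 1 else 0)) ∩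
    ⋂ A ∈ F, {x | 1 ≤ ∑ i ∈ A, x i}
  have hK : IsCompact K := by
    refine (isCompact_univ_pi fun i => isCompact_Icc).inter_right ?_
    refine isClosed_biInter fun A _ => isClosed_le continuous_const ?_
    exact continuous_finsetSum _ fun i _ => continuous_apply i
  have hKF : ∀ x, x ∈ K ↔ IsFracCover F x ∧ ∀ i, x i ≤ 1 := by
    intro x
    simp only [K, Set.mem_inter_iff, Set.mem_pi, Set.mem_univ, true_implies, Set.mem_Icc,
      Set.mem_iInter, Set.mem_ofPred_eq]
    constructor
    · rintro ⟨h1, h2⟩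
      refine ⟨⟨fun i => (h1 i).1, fun i hi => ?_, h2⟩,
        fun i => (h1 i).2.trans (by split_ifs <;> simp)⟩
      have := h1 i
      rw [if_neg hi] at this
      exact le_antisymm this.2 this.1
    · rintro ⟨h1, h2⟩
      refine ⟨fun i => ⟨h1.1 i, ?_⟩, h1.2.2⟩
      split_ifs with hi
      · exact h2 i
      · exact (h1.2.1 i hi).le
  have hne : K.Nonempty := by
    refine ⟨fun i => if i ∈ U then 1 else 0, (hKF _).2 ⟨⟨fun i => ?_, fun i hi => if_neg hi,
      fun A hA => ?_⟩, fun i => ?_⟩⟩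
    · dsimp only; split_ifs <;> simp
    · have : ∀ i ∈ A, (if i ∈ U then (1 : ℝ) else 0) = 1 := fun i hi =>
        if_pos (Finset.mem_biUnion.2 ⟨A, hA, hi⟩)
      rw [Finset.sum_congr rfl this, Finset.sum_const, nsmul_eq_mul, mul_one]
      exact_mod_cast (hF A hA).card_pos
    · split_ifs <;> simp
  obtain ⟨x, hx, hmin⟩ := hK.exists_isMinOn hne (f := fun x => ∑ i ∈ U, x i)
    (continuous_finsetSum _ fun i _ => continuous_apply i).continuousOn
  refine ⟨x, ((hKF x).1 hx).1, fun y hy => ?_⟩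
  have h := hmin ((hKF _).2 ⟨hy.truncate, fun i => min_le_right _ _⟩)
  exact (show ∑ i ∈ U, x i ≤ ∑ i ∈ U, min (y i) 1 from h).trans
    (Finset.sum_le_sum fun i _ => min_le_left _ _)

theorem lpSolution_isOpt {F : Finset (Finset ℕ)} (hF : ∀ A ∈ F, A.Nonempty) :
    IsOptFracCover F (lpSolution F) :=
  Classical.epsilon_spec (exists_isOptFracCover F hF)

section cluster

variable {V : Type*} [Fintype V] {G : SimpleGraph V} {ident : V → ℕ}

theorem clusterLP_isOpt (K : Finset V) :
    IsOptFracCover (clusterLP G ident K) (lpSolution (clusterLP G ident K)) := by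
  refine lpSolution_isOpt fun A hA => ?_
  obtain ⟨j, _, rfl⟩ := Finset.mem_image.1 hA
  exact (closedNbr_nonempty G j).image _

theorem mem_closedNbr_comm {u v : V} : u ∈ closedNbr G v ↔ v ∈ closedNbr G u := by
  rw [mem_closedNbr_iff, mem_closedNbr_iff, SimpleGraph.edist_comm]

theorem mem_clusterLP_vars (hinj : Function.Injective ident) {K : Finset V} {i : V} :
    ident i ∈ (clusterLP G ident K).biUnion id ↔ ∃ j ∈ K, i ∈ closedNbr G j := by
  classical
  simp [clusterLP, hinj.eq_iff]

theorem lpSolution_eq_zero (hinj : Function.Injective ident) {K : Finset V} {i : V}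
    (h : ¬∃ j ∈ K, i ∈ closedNbr G j) : lpSolution (clusterLP G ident K) (ident i) = 0 :=
  (clusterLP_isOpt K).1.2.1 _ (by rwa [mem_clusterLP_vars hinj])

theorem lpSolution_nonneg (K : Finset V) (a : ℕ) : 0 ≤ lpSolution (clusterLP G ident K) a :=
  (clusterLP_isOpt K).1.1 a

theorem one_le_sum_lpSolution (hinj : Function.Injective ident) {K : Finset V} {j : V}
    (hj : j ∈ K) : 1 ≤ ∑ i ∈ closedNbr G j, lpSolution (clusterLP G ident K) (ident i) := by
  classical
  have := (clusterLP_isOpt (G := G) (ident := ident) K).1.2.2 _ (Finset.mem_image_of_mem _ hj)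
  rwa [Finset.sum_image hinj.injOn] at this

/-- Adjacent clusters of one Linial–Saks instance coincide: members of different clusters have no
common neighbour. -/
theorem lsCluster_eq (hinj : Function.Injective ident) {r : V → ℕ} {y y' j j' i : V}
    (hj : j ∈ lsCluster (lsGraph G) ident r y) (hj' : j' ∈ lsCluster (lsGraph G) ident r y')
    (hi : i ∈ closedNbr G j) (hi' : i ∈ closedNbr G j') : y = y' := by
  -- `j` and `j'` are at distance at most one, so each lies within the radius of both leaders
  have key : ∀ {y y' j j' : V}, j ∈ lsCluster (lsGraph G) ident r y →
      j' ∈ lsCluster (lsGraph G) ident r y' → i ∈ closedNbr G j → i ∈ closedNbr G j' →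
      ident y ≤ ident y' := by
    intro y y' j j' hj hj' hi hi'
    obtain ⟨_, h2⟩ := mem_lsCluster_iff.1 hj
    obtain ⟨⟨_, h3⟩, _⟩ := mem_lsCluster_iff.1 hj'
    obtain ⟨h4, h5⟩ := edist_lt_nat_iff.1 h2
    refine h3 y (edist_triangle_nat (m := 1) (lsGraph_edist_le_iff.2 ?_) h5 (by omega))
    exact edist_triangle_nat (mem_closedNbr_iff.1 hi')
      (edist_comm_le (mem_closedNbr_iff.1 hi)) (by norm_num)
  exact hinj (le_antisymm (key hj hj' hi hi') (key hj' hj hi' hi))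

/-- The solutions that the clusters of one instance compute are together no larger than any
dominating set, as it contains disjoint feasible solutions for all of them. -/
theorem sum_lpSolution_le (hinj : Function.Injective ident) (r : V → ℕ) {D : Finset V}
    (hD : IsDominating G D) :
    ∑ i, ∑ y, lpSolution (clusterLP G ident (lsCluster (lsGraph G) ident r y)) (ident i) ≤
      D.card := by
  classical
  set K := lsCluster (lsGraph G) ident r
  let vars : V → Finset V := fun y => Finset.univ.filter fun i => ∃ j ∈ K y, i ∈ closedNbr G j
  have hvars : ∀ y, (clusterLP G ident (K y)).biUnion id = (vars y).image ident := by
    intro y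
    ext a
    constructor
    · intro ha
      obtain ⟨A, hA, haA⟩ := Finset.mem_biUnion.1 ha
      obtain ⟨j, hj, rfl⟩ := Finset.mem_image.1 hA
      obtain ⟨i, hi, rfl⟩ := Finset.mem_image.1 haA
      exact Finset.mem_image_of_mem _ (by simpa [vars] using ⟨j, hj, hi⟩)
    · intro ha
      obtain ⟨i, hi, rfl⟩ := Finset.mem_image.1 ha
      rw [mem_clusterLP_vars hinj]
      simpa [vars] using hi
  have hbound : ∀ y, ∑ i, lpSolution (clusterLP G ident (K y)) (ident i) ≤
      ((vars y) ∩ D).card := by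
    intro y
    have hopt := clusterLP_isOpt (G := G) (ident := ident) (K y)
    have hfeas : IsFracCover (clusterLP G ident (K y))
        fun a => if a ∈ ((vars y) ∩ D).image ident then 1 else 0 := by
      refine ⟨fun a => by dsimp only; split_ifs <;> simp, fun a ha => if_neg fun h => ha ?_, ?_⟩
      · rw [hvars]
        exact Finset.image_subset_image Finset.inter_subset_left h
      · intro A hA
        obtain ⟨j, hj, rfl⟩ := Finset.mem_image.1 hA
        obtain ⟨u, hu, hju⟩ := hD j
        have hu' : u ∈ closedNbr G j := by simpa [closedNbr] using hju
        rw [Finset.sum_image hinj.injOn]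
        have hmem : ident u ∈ ((vars y) ∩ D).image ident :=
          Finset.mem_image_of_mem _ (Finset.mem_inter.2 ⟨by simpa [vars] using ⟨j, hj, hu'⟩, hu⟩)
        calc (1 : ℝ) = if ident u ∈ ((vars y) ∩ D).image ident then 1 else 0 := by rw [if_pos hmem]
          _ ≤ _ := Finset.single_le_sum
            (f := fun i => if ident i ∈ ((vars y) ∩ D).image ident then (1 : ℝ) else 0)
            (fun i _ => by split_ifs <;> simp) hu'
    have h := hopt.2 _ hfeas
    rw [hvars, Finset.sum_image hinj.injOn, Finset.sum_image hinj.injOn] at h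
    calc ∑ i, lpSolution (clusterLP G ident (K y)) (ident i)
        = ∑ i ∈ vars y, lpSolution (clusterLP G ident (K y)) (ident i) := by
          refine (Finset.sum_subset (Finset.subset_univ _) fun i _ hi => ?_).symm
          exact lpSolution_eq_zero hinj (by simpa [vars] using hi)
      _ ≤ _ := h
      _ = ((vars y) ∩ D).card := by
          simp only [Finset.mem_image, hinj.eq_iff, exists_eq_right, Finset.sum_ite_mem,
            Finset.sum_const, nsmul_eq_mul, mul_one, ← Finset.inter_assoc, Finset.inter_self]
  rw [Finset.sum_comm]
  calc _ ≤ ∑ y, (((vars y) ∩ D).card : ℝ) := Finset.sum_le_sum fun y _ => hbound y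
    _ = ((Finset.univ.biUnion fun y => vars y ∩ D).card : ℝ) := by
      rw [Finset.card_biUnion]
      · push_cast; rfl
      · intro y _ y' _ hne
        refine Finset.disjoint_left.2 ?_
        intro i hi hi'
        obtain ⟨j, hj, hij⟩ : ∃ j ∈ K y, i ∈ closedNbr G j := by
          simpa [vars] using (Finset.mem_inter.1 hi).1
        obtain ⟨j', hj', hij'⟩ : ∃ j ∈ K y', i ∈ closedNbr G j := by
          simpa [vars] using (Finset.mem_inter.1 hi').1
        exact hne (lsCluster_eq hinj hj hj' hij hij')
    _ ≤ D.card := by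
      refine Nat.cast_le.2 (Finset.card_le_card ?_)
      exact Finset.biUnion_subset.2 fun y _ => Finset.inter_subset_right

end cluster

/-! ### Sparsification -/

section sparsify

variable {W : Type*} {H : SimpleGraph W} {ident : W → ℕ} {k : ℕ}

theorem edgeWeight_mk (a b : W) :
    edgeWeight ident s(a, b) = toLex (min (ident a) (ident b), max (ident a) (ident b)) := rfl

theorem edgeWeight_injective (hinj : Function.Injective ident) :
    Function.Injective (edgeWeight ident) := by
  intro e f
  induction e with
  | _ a b =>
  induction f with
  | _ c d =>
  intro h
  rw [edgeWeight_mk, edgeWeight_mk] at h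
  have h' := toLex.injective h
  have h1 : min (ident a) (ident b) = min (ident c) (ident d) := congrArg Prod.fst h'
  have h2 : max (ident a) (ident b) = max (ident c) (ident d) := congrArg Prod.snd h'
  have : (ident a = ident c ∧ ident b = ident d) ∨ (ident a = ident d ∧ ident b = ident c) := by
    omega
  rw [Sym2.eq_iff]
  exact this.imp (fun h => ⟨hinj h.1, hinj h.2⟩) fun h => ⟨hinj h.1, hinj h.2⟩

theorem exists_eq_append_cons_of_mem_edges {a b u v : W} (w : H.Walk a b)
    (h : s(u, v) ∈ w.edges) :
    (∃ (p : H.Walk a u) (huv : H.Adj u v) (q : H.Walk v b), w = p.append (.cons huv q)) ∨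
      ∃ (p : H.Walk a v) (hvu : H.Adj v u) (q : H.Walk u b), w = p.append (.cons hvu q) := by
  induction w with
  | nil => simp at h
  | @cons a c b hac w ih =>
    rw [SimpleGraph.Walk.edges_cons, List.mem_cons] at h
    rcases h with h | h
    · rcases Sym2.eq_iff.1 h with ⟨rfl, rfl⟩ | ⟨rfl, rfl⟩
      · exact .inl ⟨.nil, hac, w, rfl⟩
      · exact .inr ⟨.nil, hac, w, rfl⟩
    · rcases ih h with ⟨p, huv, q, rfl⟩ | ⟨p, huv, q, rfl⟩
      · exact .inl ⟨.cons hac p, huv, q, rfl⟩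
      · exact .inr ⟨.cons hac p, huv, q, rfl⟩

/-- An edge is removed iff lighter edges form a walk of length at most `2 * k - 1` between its
ends. -/
theorem sparsify_adj_iff (hinj : Function.Injective ident) {u v : W} :
    (sparsify H ident k).Adj u v ↔ H.Adj u v ∧ ¬∃ w : H.Walk u v, w.length + 1 ≤ 2 * k ∧
      ∀ e ∈ w.edges, edgeWeight ident e < edgeWeight ident s(u, v) := by
  classical
  rw [sparsify, SimpleGraph.deleteEdges_adj]
  refine and_congr_right fun huv => not_congr ⟨?_, ?_⟩
  · rintro ⟨a, c, hc, hlen, he, hmax⟩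
    -- the rest of the cycle connects the ends of the edge
    have fin : ∀ {x y : W} (hxy : H.Adj x y) (p : H.Walk a x) (q : H.Walk y a),
        c = p.append (.cons hxy q) → s(x, y) = s(u, v) →
        ∃ w : H.Walk y x, w.length + 1 ≤ 2 * k ∧
          ∀ e ∈ w.edges, edgeWeight ident e < edgeWeight ident s(u, v) := by
      rintro x y hxy p q rfl heq
      have hnd := hc.edges_nodup
      simp only [SimpleGraph.Walk.edges_append, SimpleGraph.Walk.edges_cons, heq] at hnd
      have hnot : s(u, v) ∉ p.edges ++ q.edges := (List.nodup_middle.1 hnd).notMem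
      refine ⟨q.append p, ?_, fun e he => ?_⟩
      · simp only [SimpleGraph.Walk.length_append, SimpleGraph.Walk.length_cons] at hlen ⊢
        omega
      · rw [SimpleGraph.Walk.edges_append, List.mem_append] at he
        refine lt_of_le_of_ne (hmax e ?_) fun h' => ?_
        · simp only [SimpleGraph.Walk.edges_append, SimpleGraph.Walk.edges_cons, List.mem_append,
            List.mem_cons]
          tauto
        · rw [edgeWeight_injective hinj h'] at he
          exact hnot (List.mem_append.2 he.symm)
    rcases exists_eq_append_cons_of_mem_edges c he with ⟨p, h, q, hpq⟩ | ⟨p, h, q, hpq⟩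
    · obtain ⟨w, hw, hw'⟩ := fin h p q hpq rfl
      exact ⟨w.reverse, by simpa using hw, fun e he => hw' e (by simpa using he)⟩
    · exact fin h p q hpq Sym2.eq_swap
  · rintro ⟨w, hlen, hlt⟩
    have hsub : ∀ e ∈ w.bypass.edges, e ∈ w.edges := fun e he => w.edges_bypass_subset_edges he
    refine ⟨v, .cons huv.symm w.bypass, ?_, ?_, by simp [Sym2.eq_swap], ?_⟩
    · rw [SimpleGraph.Walk.cons_isCycle_iff]
      refine ⟨w.bypass_isPath, fun h => ?_⟩
      have := hlt _ (hsub _ h)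
      rw [Sym2.eq_swap] at this
      exact this.false
    · have := w.length_bypass_le_length
      simp only [SimpleGraph.Walk.length_cons]
      omega
    · intro f hf
      rw [SimpleGraph.Walk.edges_cons, List.mem_cons] at hf
      rcases hf with rfl | hf
      · rw [Sym2.eq_swap]
      · exact (hlt _ (hsub _ hf)).le

end sparsify

/-! ### Locality of the linear programming and rounding phases -/

section local_phases

variable (n Δ k ℓ : ℕ) (α lam : ℝ)

theorem radius_le (n R : ℕ) (α : ℝ) (u : unitInterval) : radius n R α u ≤ R :=
  Nat.findGreatest_le _

/-- The radii of the nodes of a network, by instance. -/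
noncomputable def Net.radii (N : Net.{u} (Seed ℓ)) (t : Fin ℓ) (v : N.V) : ℕ :=
  radius n k α ((N.seed v).1 t)

/-- The identifiers of the leaders whose clusters contain `v`, by instance; at most one each. -/
noncomputable def Net.joined (N : Net.{u} (Seed ℓ)) (v : N.V) (t : Fin ℓ) : Finset ℕ :=
  haveI := Classical.decPred fun y => v ∈ lsCluster (lsGraph N.G) N.ident (N.radii n k ℓ α t) y
  (Finset.univ.filter fun y => v ∈ lsCluster (lsGraph N.G) N.ident (N.radii n k ℓ α t) y).image
    N.ident

variable {n Δ k ℓ α lam}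

theorem mem_joined {N : Net.{u} (Seed ℓ)} {v : N.V} {t : Fin ℓ} {a : ℕ} :
    a ∈ N.joined n k ℓ α v t ↔
      ∃ y, v ∈ lsCluster (lsGraph N.G) N.ident (N.radii n k ℓ α t) y ∧ N.ident y = a := by
  simp [Net.joined]

theorem isLocal_radii : IsLocal 0 fun (N : Net.{u} (Seed ℓ)) v t => N.radii n k ℓ α t v :=
  isLocal_seed.comp fun (s : Seed ℓ) t => radius n k α (s.1 t)

/-- Leaders lie at distance at most `k` in `lsGraph`, which is `4 * k` in the network. -/
theorem isLocal_joined : IsLocal (4 * k) fun (N : Net.{u} (Seed ℓ)) v => N.joined n k ℓ α v := by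
  refine IsLocal.of_le fun N N' v v' h t a ha => ?_
  have hF := isLocal_ident.prod (isLocal_radii (n := n) (k := k) (ℓ := ℓ) (α := α))
  obtain ⟨y, hy, rfl⟩ := mem_joined.1 ha
  obtain ⟨⟨h1, h2⟩, h3⟩ := mem_lsCluster_iff.1 hy
  obtain ⟨h4, h5⟩ := edist_lt_nat_iff.1 h3
  have hk : ∀ {N : Net.{u} (Seed ℓ)} (z : N.V), N.radii n k ℓ α t z ≤ k :=
    fun z => radius_le _ _ _ _
  have hyk := hk y
  obtain ⟨y', hy', he⟩ := hF.transfer h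
    (c := 4 * (N.radii n k ℓ α t y - 1)) (by omega) (lsGraph_edist_le_iff.1 h5)
  have hid : N.ident y = N'.ident y' := congrArg Prod.fst he
  have hrad : N.radii n k ℓ α t y = N'.radii n k ℓ α t y' := congrFun (congrArg Prod.snd he) t
  refine mem_joined.2 ⟨y', mem_lsCluster_iff.2 ⟨⟨?_, fun z' hz' => ?_⟩, ?_⟩, hid.symm⟩
  · refine lsGraph_edist_le_iff.2 (hy'.trans ?_)
    rw [← hrad]
    exact_mod_cast Nat.mul_le_mul_left 4 (Nat.sub_le _ _)
  · have hzk := hk z'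
    obtain ⟨z, hz, he'⟩ := hF.transfer h.symm
      (c := 4 * (N'.radii n k ℓ α t z')) (by omega) (lsGraph_edist_le_iff.1 hz')
    have hid' : N'.ident z' = N.ident z := congrArg Prod.fst he'
    have hrad' : N'.radii n k ℓ α t z' = N.radii n k ℓ α t z := congrFun (congrArg Prod.snd he') t
    rw [hid', ← hid]
    exact h2 z (lsGraph_edist_le_iff.2 (hrad' ▸ hz))
  · exact edist_lt_nat_iff.2 ⟨hrad ▸ h4, lsGraph_edist_le_iff.2 (hrad ▸ hy')⟩

open Classical in
/-- A local LP in terms of the identifiers and of `Net.joined`, which are local quantities. -/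
theorem clusterLP_eq {N : Net.{u} (Seed ℓ)} {t : Fin ℓ} (y : N.V) :
    clusterLP N.G N.ident (lsCluster (lsGraph N.G) N.ident (N.radii n k ℓ α t) y) =
      (Finset.univ.filter fun j => N.ident y ∈ N.joined n k ℓ α j t).image
        fun j => (closedNbr N.G j).image N.ident := by
  rw [clusterLP]
  congr 1
  ext j
  simp [mem_joined, N.inj.eq_iff]

/-- The members of a cluster next to a node lie within distance `8 * k`, and their inequalities
and clusters are determined by their views after `4 * k + 1` rounds. -/
theorem isLocal_lpSum :
    IsLocal (12 * k + 1) fun (N : Net.{u} (Seed ℓ)) v =>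
      lpSum N.G N.ident (N.radii n k ℓ α) v := by
  classical
  let A : ∀ N : Net.{u} (Seed ℓ), N.V → Fin ℓ → Finset ℕ := fun N v t =>
    (closedNbr N.G v).biUnion fun j => N.joined n k ℓ α j t
  let F : ∀ N : Net.{u} (Seed ℓ), Fin ℓ → ℕ → Finset (Finset ℕ) := fun N t a =>
    (Finset.univ.filter fun j => a ∈ N.joined n k ℓ α j t).image
        fun j => (closedNbr N.G j).image N.ident
  have hnb : IsLocal (4 * k + 1) fun (N : Net.{u} (Seed ℓ)) j =>
      ((closedNbr N.G j).image N.ident, N.joined n k ℓ α j) :=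
    (isLocal_ident.image_closedNbr.mono (by omega : 0 + 1 ≤ 4 * k + 1)).prod
      (isLocal_joined.mono (by omega))
  -- only the clusters that meet the neighbourhood contribute
  have key : ∀ (N : Net.{u} (Seed ℓ)) v, lpSum N.G N.ident (N.radii n k ℓ α) v =
      ∑ t, ∑ a ∈ A N v t, lpSolution (F N t a) (N.ident v) := by
    intro N v
    refine Finset.sum_congr rfl fun t _ => ?_
    calc ∑ y, lpSolution (clusterLP N.G N.ident
          (lsCluster (lsGraph N.G) N.ident (N.radii n k ℓ α t) y)) (N.ident v)
        = ∑ y, lpSolution (F N t (N.ident y)) (N.ident v) :=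
          Finset.sum_congr rfl fun y _ => by rw [clusterLP_eq]
      _ = ∑ a ∈ Finset.univ.image N.ident, lpSolution (F N t a) (N.ident v) :=
          (Finset.sum_image (f := fun a => lpSolution (F N t a) (N.ident v)) N.inj.injOn).symm
      _ = _ := by
        refine (Finset.sum_subset ?_ ?_).symm
        · intro a ha
          obtain ⟨j, _, hj⟩ := Finset.mem_biUnion.1 ha
          obtain ⟨y, _, rfl⟩ := mem_joined.1 hj
          exact Finset.mem_image_of_mem _ (Finset.mem_univ y)
        · intro a ha ha'
          obtain ⟨y, _, rfl⟩ := Finset.mem_image.1 ha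
          simp only [F]
          rw [← clusterLP_eq]
          refine lpSolution_eq_zero N.inj ?_
          rintro ⟨j, hj, hvj⟩
          exact ha' (Finset.mem_biUnion.2
            ⟨j, mem_closedNbr_comm.1 hvj, mem_joined.2 ⟨y, hj, rfl⟩⟩)
  have hAle : ∀ (N N' : Net.{u} (Seed ℓ)) v v', N.view (12 * k + 1) v = N'.view (12 * k + 1) v' →
      A N v ≤ A N' v' := by
    intro N N' v v' h t a ha
    obtain ⟨j, hj, haj⟩ := Finset.mem_biUnion.1 ha
    obtain ⟨j', hj', he⟩ := (isLocal_joined (n := n) (k := k) (α := α)).transfer h (c := 1)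
      (by omega) (mem_closedNbr_iff.1 hj)
    exact Finset.mem_biUnion.2 ⟨j', mem_closedNbr_iff.2 hj', by rw [← he]; exact haj⟩
  have hFle : ∀ (N N' : Net.{u} (Seed ℓ)) v v', N.view (12 * k + 1) v = N'.view (12 * k + 1) v' →
      ∀ t, ∀ a ∈ A N v t, F N t a ≤ F N' t a := by
    intro N N' v v' h t a ha B hB
    obtain ⟨j, hj, rfl⟩ := Finset.mem_image.1 hB
    obtain ⟨j₀, hj₀, ha₀⟩ := Finset.mem_biUnion.1 ha
    have hj' := (Finset.mem_filter.1 hj).2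
    obtain ⟨y, hy, rfl⟩ := mem_joined.1 hj'
    obtain ⟨y₀, hy₀, hyy⟩ := mem_joined.1 ha₀
    obtain rfl := N.inj hyy
    by_cases hk0 : k = 0
    · have := (mem_lsCluster_iff.1 hy).2
      have h0 : N.radii n k ℓ α t y₀ = 0 := Nat.le_zero.1 ((radius_le _ _ _ _).trans hk0.le)
      simp [h0] at this
    -- members of a cluster are strictly within the radius of their leader
    have hlt : ∀ j : N.V, j ∈ lsCluster (lsGraph N.G) N.ident (N.radii n k ℓ α t) y₀ →
        N.G.edist j y₀ ≤ ((4 * k - 1 : ℕ) : ℕ∞) := by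
      intro j hj
      obtain ⟨h1, h2⟩ := edist_lt_nat_iff.1 (mem_lsCluster_iff.1 hj).2
      have h3 : N.radii n k ℓ α t y₀ ≤ k := radius_le _ _ _ _
      exact (lsGraph_edist_le_iff.1 h2).trans (Nat.cast_le.2
        (show 4 * (N.radii n k ℓ α t y₀ - 1) ≤ 4 * k - 1 by omega))
    have hdist : N.G.edist v j ≤ ((8 * k : ℕ) : ℕ∞) := by
      refine edist_triangle_nat (mem_closedNbr_iff.1 hj₀) (n := 8 * k - 2)
        (edist_triangle_nat (hlt j₀ hy₀) (edist_comm_le (hlt j hy)) ?_) ?_ <;> omega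
    obtain ⟨j', -, he⟩ := hnb.transfer h (c := 8 * k) (by omega) hdist
    refine Finset.mem_image.2 ⟨j', Finset.mem_filter.2 ⟨Finset.mem_univ _, ?_⟩, ?_⟩
    · rwa [← show N.joined n k ℓ α j = N'.joined n k ℓ α j' from congrArg Prod.snd he]
    · exact (congrArg Prod.fst he).symm
  intro N N' v v' h
  simp only [key]
  have hid : N.ident v = N'.ident v' := isLocal_ident.mono (Nat.zero_le _) N N' v v' h
  have hAeq := le_antisymm (hAle N N' v v' h) (hAle N' N v' v h.symm)
  refine Finset.sum_congr rfl fun t _ => ?_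
  rw [← hAeq, ← hid]
  refine Finset.sum_congr rfl fun a ha => ?_
  rw [le_antisymm (hFle N N' v v' h t a ha) (hFle N' N v' v h.symm t a (hAeq ▸ ha))]

theorem isLocal_fracDS :
    IsLocal (12 * k + 3) fun (N : Net.{u} (Seed ℓ)) v =>
      fracDS N.G N.ident (N.radii n k ℓ α) v :=
  ((isLocal_lpSum.mono (by omega)).prod
    isLocal_lpSum.sum_closedNbr.inf'_closedNbr).comp fun p => p.1 / p.2

/-- The outcome of the rounding phase. -/
noncomputable def Net.roundedSet (N : Net.{u} (Seed ℓ)) (n Δ k : ℕ) (α lam : ℝ) : Finset N.V :=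
  roundedDS N.G Δ lam (fracDS N.G N.ident (N.radii n k ℓ α)) fun v => (N.seed v).2

theorem isLocal_roundedSet :
    IsLocal (12 * k + 4) fun (N : Net.{u} (Seed ℓ)) v => v ∈ N.roundedSet n Δ k α lam := by
  have h : IsLocal (12 * k + 3) fun (N : Net.{u} (Seed ℓ)) v =>
      roundVar Δ lam (fracDS N.G N.ident (N.radii n k ℓ α) v) (N.seed v).2 :=
    (isLocal_fracDS.prod (isLocal_seed.mono (by omega))).comp fun p => roundVar Δ lam p.1 p.2.2
  have h' := ((h.mono (Nat.le_succ _)).prod h.sum_closedNbr).comp fun p => 1 ≤ p.1 + (1 - p.2)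
  simpa only [Net.roundedSet, roundedDS, Finset.mem_filter, Finset.mem_univ, true_and, intDS]
    using h'

/-! ### Locality of the connecting phase -/

/-- The pairs of identifiers `(a, b)` such that the node with identifier `a` reaches `x` in the
graph on the rounded set by at most `m` edges, all lighter than an edge with ends `a` and `b`. -/
def Net.lightReach (N : Net.{u} (Seed ℓ)) (n Δ k : ℕ) (α lam : ℝ) (m : ℕ) (x : N.V) :
    Set (ℕ × ℕ) :=
  {p | ∃ (hx : x ∈ N.roundedSet n Δ k α lam) (z : {v // v ∈ N.roundedSet n Δ k α lam})
    (w : (domGraph N.G (N.roundedSet n Δ k α lam)).Walk ⟨x, hx⟩ z), N.ident z.1 = p.1 ∧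
      w.length ≤ m ∧ ∀ e ∈ w.edges,
        edgeWeight (fun v => N.ident v.1) e < toLex (min p.1 p.2, max p.1 p.2)}

/-- Each further edge of a walk in the graph on the rounded set bridges at most `3` edges of the
network. -/
theorem isLocal_lightReach (m : ℕ) :
    IsLocal (12 * k + 4 + 3 * m) fun (N : Net.{u} (Seed ℓ)) v =>
      N.lightReach n Δ k α lam m v := by
  have hM : ∀ s, IsLocal (12 * k + 4 + s) fun (N : Net.{u} (Seed ℓ)) v =>
      (N.ident v, v ∈ N.roundedSet n Δ k α lam) := fun s =>
    (isLocal_ident.mono (by omega)).prod (isLocal_roundedSet.mono (by omega))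
  induction m with
  | zero =>
    refine IsLocal.of_le fun N N' v v' h => ?_
    rintro ⟨a, b⟩ ⟨hx, z, w, hz, hl, -⟩
    have he := hM _ N N' v v' h
    cases w with
    | nil =>
      refine ⟨(congrArg Prod.snd he).mp hx, _, .nil, ?_, by simp, by simp⟩
      exact (congrArg Prod.fst he).symm.trans hz
    | cons => simp at hl
  | succ m ih =>
    refine IsLocal.of_le fun N N' v v' h => ?_
    rintro ⟨a, b⟩ ⟨hx, z, w, hz, hl, hw⟩
    have he := hM _ N N' v v' h
    have hid : N.ident v = N'.ident v' := congrArg Prod.fst he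
    have hx' : v' ∈ N'.roundedSet n Δ k α lam := (congrArg Prod.snd he).mp hx
    cases w with
    | nil => exact ⟨hx', _, .nil, hid.symm.trans hz, by simp, by simp⟩
    | @cons _ y _ hvy w =>
      have hd : N.G.edist v y.1 ≤ ((3 : ℕ) : ℕ∞) := hvy.2
      obtain ⟨y', hy', he'⟩ := ((isLocal_ident.mono (by omega)).prod ih).transfer h (c := 3)
        (by omega) hd
      have hidy : N.ident y.1 = N'.ident y' := congrArg Prod.fst he'
      have hr : N.lightReach n Δ k α lam m y.1 = N'.lightReach n Δ k α lam m y' :=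
        congrArg Prod.snd he'
      rw [SimpleGraph.Walk.length_cons] at hl
      have hmem : (a, b) ∈ N.lightReach n Δ k α lam m y.1 :=
        ⟨y.2, z, w, hz, by omega, fun e he => hw e (by simp [he])⟩
      rw [hr] at hmem
      obtain ⟨hyD, z', w', hz', hl', hw'⟩ := hmem
      have hadj : (domGraph N'.G (N'.roundedSet n Δ k α lam)).Adj ⟨v', hx'⟩ ⟨y', hyD⟩ := by
        exact ⟨fun heq => hvy.1 (Subtype.ext (N.inj (hid.trans
          ((congrArg (fun s => N'.ident s.1) heq).trans hidy.symm)))), hy'⟩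
      refine ⟨hx', z', .cons hadj w', hz', by simpa using hl', fun e he => ?_⟩
      rw [SimpleGraph.Walk.edges_cons, List.mem_cons] at he
      rcases he with rfl | he
      · have := hw s(⟨v, hx⟩, y) (by simp)
        rw [edgeWeight_mk] at this ⊢
        rwa [← hid, ← hidy]
      · exact hw' e he

/-- The graph of the remaining edges after the sparsification. -/
noncomputable def Net.sparse (N : Net.{u} (Seed ℓ)) (n Δ k : ℕ) (α lam : ℝ) :
    SimpleGraph {v // v ∈ N.roundedSet n Δ k α lam} :=
  sparsify (domGraph N.G (N.roundedSet n Δ k α lam)) (fun w => N.ident w.1) k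

/-- The remaining edges are recognized by lighter walks between their ends, which is local, in place
of cycles, of which a node does not see the whole. -/
theorem sparse_adj_iff (hk : 1 ≤ k) {N : Net.{u} (Seed ℓ)}
    {u v : {v // v ∈ N.roundedSet n Δ k α lam}} :
    (N.sparse n Δ k α lam).Adj u v ↔ u ≠ v ∧ N.G.edist u.1 v.1 ≤ ((3 : ℕ) : ℕ∞) ∧
      (N.ident v.1, N.ident u.1) ∉ N.lightReach n Δ k α lam (2 * k - 1) u.1 := by
  rw [Net.sparse, sparsify_adj_iff (ident := fun w => N.ident w.1)
    fun a b h => Subtype.ext (N.inj h)]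
  rw [show (domGraph N.G (N.roundedSet n Δ k α lam)).Adj u v ↔
    u ≠ v ∧ N.G.edist u.1 v.1 ≤ ((3 : ℕ) : ℕ∞) from Iff.rfl, and_assoc]
  refine and_congr_right fun _ => and_congr_right fun _ => not_congr ⟨?_, ?_⟩
  · rintro ⟨w, hl, hw⟩
    refine ⟨u.2, v, w, rfl, by omega, fun e he => ?_⟩
    have := hw e he
    rw [edgeWeight_mk] at this
    dsimp only
    rwa [min_comm, max_comm]
  · rintro ⟨hu, z, w, hz, hl, hw⟩
    obtain rfl : z = v := Subtype.ext (N.inj hz)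
    refine ⟨w, by omega, fun e he => ?_⟩
    have := hw e he
    dsimp only at this
    rw [edgeWeight_mk]
    rwa [min_comm, max_comm] at this

/-- The identifier lists of the walks of length `m` that start at `x`. -/
def Net.walkLists (N : Net.{u} (Seed ℓ)) (m : ℕ) (x : N.V) : Set (List ℕ) :=
  {L | ∃ (y : N.V) (w : N.G.Walk x y), w.length = m ∧ L = w.support.map N.ident}

theorem isLocal_walkLists (m : ℕ) :
    IsLocal m fun (N : Net.{u} (Seed ℓ)) v => N.walkLists m v := by
  induction m with
  | zero =>
    refine IsLocal.of_le fun N N' v v' h => ?_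
    rintro _ ⟨y, w, hw, rfl⟩
    cases w with
    | nil => exact ⟨v', .nil, rfl, by simp [isLocal_ident N N' v v' h]⟩
    | cons => simp at hw
  | succ m ih =>
    refine IsLocal.of_le fun N N' v v' h => ?_
    rintro _ ⟨y, w, hw, rfl⟩
    cases w with
    | nil => simp at hw
    | @cons _ x _ hvx w =>
      have hd : N.G.edist v x ≤ ((1 : ℕ) : ℕ∞) := edist_le_one_iff.2 (.inr hvx)
      obtain ⟨x', hx', he⟩ := ((isLocal_ident.mono (Nat.zero_le m)).prod ih).transfer h le_rfl hd
      have hid := isLocal_ident.mono (Nat.zero_le _) N N' v v' h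
      have hidx : N.ident x = N'.ident x' := congrArg Prod.fst he
      have hw2 : w.support.map N.ident ∈ N.walkLists m x := ⟨y, w, by simpa using hw, rfl⟩
      rw [show N.walkLists m x = N'.walkLists m x' from congrArg Prod.snd he] at hw2
      obtain ⟨y', w', hl, heq⟩ := hw2
      have hadj : N'.G.Adj v' x' := by
        rcases edist_le_one_iff.1 hx' with rfl | hadj
        · exact absurd (N.inj (hid.trans hidx.symm)) hvx.ne
        · exact hadj
      exact ⟨y', .cons hadj w', by simp [hl], by simp [heq, hid]⟩

theorem getLast?_map_support {V : Type*} {G : SimpleGraph V} (ident : V → ℕ) {a b : V}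
    (w : G.Walk a b) : (w.support.map ident).getLast? = some (ident b) := by
  rw [List.getLast?_map, List.getLast?_eq_getLast_of_ne_nil w.support_ne_nil,
    SimpleGraph.Walk.getLast_support]
  rfl

/-- The chosen shortest path from `x` depends only on the distance of its ends and on the
identifier lists of the walks from `x` of that length. -/
theorem shortestPath_eq (N : Net.{u} (Seed ℓ)) (x y : N.V) :
    shortestPath N.G N.ident x y = Classical.epsilon fun L =>
      L ∈ N.walkLists (N.G.dist x y) x ∧ L.getLast? = some (N.ident y) := by
  rw [shortestPath]
  congr 1
  ext L
  constructor
  · rintro ⟨w, hw, rfl⟩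
    exact ⟨⟨y, w, hw, rfl⟩, getLast?_map_support _ _⟩
  · rintro ⟨⟨z, w, hw, rfl⟩, hL⟩
    rw [getLast?_map_support] at hL
    obtain rfl := N.inj (Option.some.inj hL)
    exact ⟨w, hw, rfl⟩

theorem exists_walk_of_mem_shortestPath {V : Type*} {G : SimpleGraph V} {ident : V → ℕ} {x y : V}
    (h : G.Reachable x y) :
    ∃ w : G.Walk x y, w.length = G.dist x y ∧ shortestPath G ident x y = w.support.map ident := by
  obtain ⟨w, hw⟩ := h.exists_walk_length_eq_dist
  exact Classical.epsilon_spec (p := fun L => ∃ w : G.Walk x y, w.length = G.dist x y ∧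
    L = w.support.map ident) ⟨_, w, hw, rfl⟩

theorem dist_le_of_edist_le {V : Type*} {G : SimpleGraph V} {x y : V} {c : ℕ}
    (h : G.edist x y ≤ (c : ℕ∞)) : G.dist x y ≤ c := by
  obtain ⟨w, hw⟩ := (edist_le_iff_exists_walk _ _ _ _).1 h
  exact (SimpleGraph.dist_le w).trans hw

theorem edist_le_of_dist_le {V : Type*} {G : SimpleGraph V} {x y : V} {c : ℕ}
    (hr : G.Reachable x y) (h : G.dist x y ≤ c) : G.edist x y ≤ (c : ℕ∞) := by
  obtain ⟨w, hw⟩ := hr.exists_walk_length_eq_dist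
  exact (edist_le_iff_exists_walk _ _ _ _).2 ⟨w, hw.trans_le h⟩

/-- The identifiers on the paths that connect `x` to nodes of larger identifier. -/
def Net.pathIds (N : Net.{u} (Seed ℓ)) (n Δ k : ℕ) (α lam : ℝ) (x : N.V) : Set ℕ :=
  {a | ∃ (hx : x ∈ N.roundedSet n Δ k α lam) (y : {v // v ∈ N.roundedSet n Δ k α lam}),
    (N.sparse n Δ k α lam).Adj ⟨x, hx⟩ y ∧ N.ident x < N.ident y.1 ∧
      a ∈ shortestPath N.G N.ident x y.1}

theorem isLocal_pathIds (hk : 1 ≤ k) :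
    IsLocal (12 * k + 4 + 3 * (2 * k - 1)) fun (N : Net.{u} (Seed ℓ)) v =>
      N.pathIds n Δ k α lam v := by
  refine IsLocal.of_le fun N N' v v' h a => ?_
  rintro ⟨hv, y, hadj, hlt, ha⟩
  have hM : IsLocal (12 * k + 4) fun (N : Net.{u} (Seed ℓ)) v =>
      (N.ident v, v ∈ N.roundedSet n Δ k α lam) :=
    (isLocal_ident.mono (by omega)).prod isLocal_roundedSet
  have he := hM.mono (Nat.le_add_right _ _) N N' v v' h
  have hid : N.ident v = N'.ident v' := congrArg Prod.fst he
  have hv' : v' ∈ N'.roundedSet n Δ k α lam := (congrArg Prod.snd he).mp hv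
  obtain ⟨hne, hd, hnot⟩ := (sparse_adj_iff hk).1 hadj
  obtain ⟨y', hy', hey⟩ := hM.transfer h (c := 3) (by omega) hd
  have hidy : N.ident y.1 = N'.ident y' := congrArg Prod.fst hey
  have hyD' : y' ∈ N'.roundedSet n Δ k α lam := (congrArg Prod.snd hey).mp y.2
  have hadj' : (N'.sparse n Δ k α lam).Adj ⟨v', hv'⟩ ⟨y', hyD'⟩ := by
    refine (sparse_adj_iff hk).2 ⟨fun heq => hne (Subtype.ext (N.inj (hid.trans
      ((congrArg (fun s => N'.ident s.1) heq).trans hidy.symm)))), hy', ?_⟩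
    have hL : N.lightReach n Δ k α lam (2 * k - 1) v = N'.lightReach n Δ k α lam (2 * k - 1) v' :=
      isLocal_lightReach (2 * k - 1) N N' v v' h
    dsimp only at hnot ⊢
    rwa [← hid, ← hidy, ← hL]
  refine ⟨hv', ⟨y', hyD'⟩, hadj', by rw [← hid]; exact hidy ▸ hlt, ?_⟩
  have hr : N.G.Reachable v y.1 := SimpleGraph.reachable_of_edist_ne_top
    (ne_top_of_le_ne_top (ENat.natCast_ne_top 3) hd)
  have hr' : N'.G.Reachable v' y' := SimpleGraph.reachable_of_edist_ne_top
    (ne_top_of_le_ne_top (ENat.natCast_ne_top 3) hy')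
  have hd3 : N.G.dist v y.1 ≤ 3 := dist_le_of_edist_le hd
  have hd3' := dist_le_of_edist_le hy'
  have hdist : N.G.dist v y.1 = N'.G.dist v' y' := le_antisymm
    (dist_le_of_edist_le (edist_le_of_view_eq h.symm (by omega) hidy.symm
      (edist_le_of_dist_le hr' le_rfl)))
    (dist_le_of_edist_le (edist_le_of_view_eq h (by omega) hidy (edist_le_of_dist_le hr le_rfl)))
  rw [shortestPath_eq] at ha ⊢
  dsimp only
  rw [← hdist, ← hidy]
  have hW : N.walkLists (N.G.dist v y.1) v = N'.walkLists (N.G.dist v y.1) v' :=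
    (isLocal_walkLists _).mono (by omega) N N' v v' h
  rwa [hW] at ha

theorem mem_mcds_iff {N : Net.{u} (Seed ℓ)} {v : N.V} :
    v ∈ mcds N.G N.ident n Δ k ℓ α lam N.seed ↔ v ∈ N.roundedSet n Δ k α lam ∨
      ∃ x, N.G.edist v x ≤ ((3 : ℕ) : ℕ∞) ∧ N.ident v ∈ N.pathIds n Δ k α lam x := by
  classical
  rw [mcds]
  simp only [connectDS, Finset.mem_union, Finset.mem_filter, Finset.mem_univ, true_and]
  refine or_congr_right ⟨?_, ?_⟩
  · rintro ⟨x, y, hadj, hlt, hv⟩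
    refine ⟨x.1, ?_, x.2, y, hadj, hlt, hv⟩
    -- a node of a shortest path is no farther from its start than the end is
    have hd : N.G.edist x.1 y.1 ≤ ((3 : ℕ) : ℕ∞) := (SimpleGraph.deleteEdges_le _ hadj).2
    obtain ⟨w, hw, heq⟩ := exists_walk_of_mem_shortestPath (ident := N.ident)
      (SimpleGraph.reachable_of_edist_ne_top (ne_top_of_le_ne_top (ENat.natCast_ne_top 3) hd))
    rw [heq, List.mem_map_of_injective N.inj] at hv
    refine edist_comm_le ((edist_le_iff_exists_walk _ _ _ _).2 ⟨w.takeUntil v hv, ?_⟩)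
    exact (w.length_takeUntil_le_length hv).trans (hw.trans_le (dist_le_of_edist_le hd))
  · rintro ⟨x, -, hx, y, hadj, hlt, hv⟩
    exact ⟨⟨x, hx⟩, y, hadj, hlt, hv⟩

/-- The phases add up to `12 * k + 4`, `6 * k - 3` and `3` rounds. -/
theorem isLocal_mcds (hk : 1 ≤ k) :
    IsLocal (22 * k) fun (N : Net.{u} (Seed ℓ)) v =>
      v ∈ mcds N.G N.ident n Δ k ℓ α lam N.seed := by
  refine IsLocal.of_le fun N N' v v' h => ?_
  simp only [mem_mcds_iff]
  refine Or.imp (fun hv => ?_) ?_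
  · exact (isLocal_roundedSet.mono (by omega) N N' v v' h).mp hv
  · rintro ⟨x, hx, hv⟩
    obtain ⟨x', hx', he⟩ := (isLocal_pathIds hk).transfer h (c := 3) (by omega) hx
    refine ⟨x', hx', ?_⟩
    rw [← he, ← show N.ident v = N'.ident v' from isLocal_ident.mono (Nat.zero_le _) N N' v v' h]
    exact hv

/-- The result of the three phases is computed in `22 * k` rounds by an algorithm that depends only
on the parameters. -/
theorem exists_localAlg_mcds (n Δ ℓ : ℕ) (α lam : ℝ) (hk : 1 ≤ k) :
    ∃ A : LocalAlg (Seed ℓ) Bool, ∀ (V : Type u) [Fintype V] (G : SimpleGraph V) (ident : V → ℕ),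
      Function.Injective ident → ∀ port : V → V → ℕ, IsPortNumbering G port →
        ∀ ω : V → Seed ℓ,
          A.outputSet G ident port ω (22 * k) = mcds G ident n Δ k ℓ α lam ω := by
  refine ⟨viewAlg (Seed ℓ) (22 * k) fun (N : Net.{u} (Seed ℓ)) v =>
      v ∈ mcds N.G N.ident n Δ k ℓ α lam N.seed, fun V _ G ident hinj port hport ω => ?_⟩
  refine (viewAlg_outputSet (22 * k) (isLocal_mcds hk) ⟨V, G, ident, hinj, ω⟩ port hport).trans ?_
  ext v
  simp

end local_phases

/-! ### The result is a connected dominating set -/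

section connected

variable {V : Type*} {G : SimpleGraph V}

theorem mem_roundedDS [Fintype V] {Δ : ℕ} {lam : ℝ} {x : V → ℝ} {coin : V → unitInterval} {v : V} :
    v ∈ roundedDS G Δ lam x coin ↔ 1 ≤ intDS G Δ lam x coin v := by
  rw [roundedDS, Finset.mem_filter, and_iff_right (Finset.mem_univ v)]

theorem isDominating_roundedDS [Fintype V] (Δ : ℕ) (lam : ℝ) (x : V → ℝ)
    (coin : V → unitInterval) : IsDominating G (roundedDS G Δ lam x coin) := by
  intro v
  by_cases h : ∑ u ∈ closedNbr G v, roundVar Δ lam (x u) (coin u) = 0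
  · refine ⟨v, ?_, .inl rfl⟩
    rw [mem_roundedDS, intDS, h]
    omega
  · obtain ⟨u, hu, hne⟩ := Finset.exists_ne_zero_of_sum_ne_zero h
    refine ⟨u, ?_, by simpa [closedNbr] using hu⟩
    rw [mem_roundedDS, intDS]
    omega

/-- Dominators of adjacent nodes are at distance at most `3`. -/
theorem domGraph_connected (hG : G.Connected) {D : Finset V} (hD : IsDominating G D) :
    (domGraph G D).Connected := by
  have hdom : ∀ v, ∃ u : {u // u ∈ D}, G.edist v u.1 ≤ ((1 : ℕ) : ℕ∞) := fun v => by
    obtain ⟨u, hu, h⟩ := hD v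
    exact ⟨⟨u, hu⟩, edist_le_one_iff.2 (h.imp_left Eq.symm)⟩
  have hreach : ∀ u v : {u // u ∈ D}, G.edist u.1 v.1 ≤ ((3 : ℕ) : ℕ∞) →
      (domGraph G D).Reachable u v := by
    intro u v h
    by_cases huv : u = v
    · rw [huv]
    · exact SimpleGraph.Adj.reachable ⟨huv, h⟩
  have key : ∀ {a b : V} (w : G.Walk a b) (u v : {u // u ∈ D}),
      G.edist a u.1 ≤ ((1 : ℕ) : ℕ∞) → G.edist b v.1 ≤ ((1 : ℕ) : ℕ∞) →
      (domGraph G D).Reachable u v := by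
    intro a b w
    induction w with
    | nil =>
      exact fun u v hu hv => hreach u v (edist_triangle_nat (edist_comm_le hu) hv (by norm_num))
    | @cons a c b h w ih =>
      intro u v hu hv
      obtain ⟨x, hx⟩ := hdom c
      refine (hreach u x ?_).trans (ih x v hx hv)
      exact edist_triangle_nat (edist_comm_le hu)
        (edist_triangle_nat (edist_le_one_iff.2 (.inr h)) hx le_rfl) (by norm_num)
  have : Nonempty {u // u ∈ D} := by
    obtain ⟨v⟩ := hG.nonempty
    obtain ⟨u, hu, _⟩ := hD v
    exact ⟨⟨u, hu⟩⟩
  refine SimpleGraph.Connected.mk fun u v => ?_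
  obtain ⟨w⟩ := hG.preconnected u.1 v.1
  exact key w u v (by simp) (by simp)

/-- The removed edges are replaced by lighter ones, so connectivity is kept. -/
theorem sparsify_connected {W : Type*} {H : SimpleGraph W} {ident : W → ℕ}
    (hinj : Function.Injective ident) (k : ℕ) (hH : H.Connected) :
    (sparsify H ident k).Connected := by
  have key : ∀ (c : ℕ ×ₗ ℕ) (u v : W), edgeWeight ident s(u, v) = c → H.Adj u v →
      (sparsify H ident k).Reachable u v := by
    intro c
    induction c using WellFoundedLT.induction with
    | _ c ih =>
      rintro u v rfl huv
      by_cases hadj : (sparsify H ident k).Adj u v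
      · exact hadj.reachable
      rw [sparsify_adj_iff hinj, not_and, not_not] at hadj
      obtain ⟨w, -, hw⟩ := hadj huv
      have : ∀ {a b : W} (w : H.Walk a b), (∀ e ∈ w.edges, edgeWeight ident e <
          edgeWeight ident s(u, v)) → (sparsify H ident k).Reachable a b := by
        intro a b w
        induction w with
        | nil => exact fun _ => .refl _
        | @cons a x b h w ihw =>
          intro hw
          exact (ih _ (hw s(a, x) (by simp)) a x rfl h).trans
            (ihw fun e he => hw e (by simp [he]))
      exact this w hw
  have := hH.nonempty
  refine SimpleGraph.Connected.mk fun u v => ?_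
  obtain ⟨w⟩ := hH.preconnected u v
  induction w with
  | nil => exact .refl _
  | cons h w ih => exact (key _ _ _ rfl h).trans ih

theorem isCDS_connectDS [Fintype V] {ident : V → ℕ} (hinj : Function.Injective ident) (k : ℕ)
    (hG : G.Connected) {D : Finset V} (hD : IsDominating G D) :
    IsCDS G (connectDS G ident k D) := by
  classical
  set D' := connectDS G ident k D with hD'
  have hsub : D ⊆ D' := by rw [hD', connectDS]; exact Finset.subset_union_left
  refine ⟨fun v => (hD v).imp fun u h => ⟨hsub h.1, h.2⟩, ?_⟩
  set S := sparsify (domGraph G D) (fun w => ident w.1) k with hS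
  have hcon : S.Connected :=
    sparsify_connected (fun a b h => Subtype.ext (hinj h)) k (domGraph_connected hG hD)
  have hpath : ∀ u v : {v // v ∈ D}, S.Adj u v → ident u.1 < ident v.1 →
      ∃ w : G.Walk u.1 v.1, (∀ x ∈ w.support, x ∈ (D' : Set V)) ∧
        shortestPath G ident u.1 v.1 = w.support.map ident := by
    intro u v hadj hlt
    obtain ⟨w, -, hw⟩ := exists_walk_of_mem_shortestPath (ident := ident)
      (hG.preconnected u.1 v.1)
    refine ⟨w, fun x hx => ?_, hw⟩
    rw [hD', connectDS, Finset.mem_coe, Finset.mem_union, Finset.mem_filter]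
    exact .inr ⟨Finset.mem_univ _, u, v, hadj, hlt, hw ▸ List.mem_map_of_mem hx⟩
  have hin : ∀ u : {v // v ∈ D}, u.1 ∈ (D' : Set V) := fun u => hsub u.2
  have hedge : ∀ u v : {v // v ∈ D}, S.Adj u v →
      (G.induce (D' : Set V)).Reachable ⟨u.1, hin u⟩ ⟨v.1, hin v⟩ := by
    intro u v hadj
    rcases lt_trichotomy (ident u.1) (ident v.1) with h | h | h
    · obtain ⟨w, hw, -⟩ := hpath u v hadj h
      exact ⟨w.induce _ hw⟩
    · exact absurd (Subtype.ext (hinj h)) hadj.ne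
    · obtain ⟨w, hw, -⟩ := hpath v u hadj.symm h
      exact SimpleGraph.Reachable.symm ⟨w.induce _ hw⟩
  have hall : ∀ u v : {v // v ∈ D},
      (G.induce (D' : Set V)).Reachable ⟨u.1, hin u⟩ ⟨v.1, hin v⟩ := by
    intro u v
    obtain ⟨w⟩ := hcon.preconnected u v
    induction w with
    | nil => exact .refl _
    | cons h w ih => exact (hedge _ _ h).trans ih
  have hto : ∀ x : (D' : Set V), ∃ u : {v // v ∈ D},
      (G.induce (D' : Set V)).Reachable x ⟨u.1, hin u⟩ := by
    rintro ⟨x, hx⟩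
    have hx' := hx
    rw [hD', connectDS, Finset.mem_coe, Finset.mem_union, Finset.mem_filter] at hx'
    rcases hx' with hx' | ⟨-, u, v, hadj, hlt, hxp⟩
    · exact ⟨⟨x, hx'⟩, .refl _⟩
    · obtain ⟨w, hw, heq⟩ := hpath u v hadj hlt
      rw [heq, List.mem_map_of_injective hinj] at hxp
      refine ⟨u, SimpleGraph.Reachable.symm ⟨(w.takeUntil x hxp).induce _ fun y hy => hw y ?_⟩⟩
      exact w.support_takeUntil_subset_support hxp hy
  obtain ⟨u₀⟩ := hcon.nonempty
  have : Nonempty (D' : Set V) := ⟨⟨u₀.1, hin u₀⟩⟩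
  refine SimpleGraph.Connected.mk fun x y => ?_
  obtain ⟨u, hu⟩ := hto x
  obtain ⟨v, hv⟩ := hto y
  exact hu.trans ((hall u v).trans hv.symm)

end connected

/-! ### Graphs without short cycles -/

section girth

variable {W : Type*} {H : SimpleGraph W} {k : ℕ}

/-- The edges of two different paths with the same ends contain a cycle. -/
theorem path_eq_of_no_short_cycle
    (hno : ∀ (a : W) (c : H.Walk a a), c.IsCycle → 2 * k < c.length) {u v : W} {p q : H.Walk u v}
    (hp : p.IsPath) (hq : q.IsPath) (hpk : p.length ≤ k) (hqk : q.length ≤ k) : p = q := by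
  classical
  let E : Set (Sym2 W) := {e | e ∈ p.edges ∨ e ∈ q.edges}
  let H' := SimpleGraph.fromEdgeSet E
  have hmem : ∀ e, e ∈ H'.edgeSet ↔ e ∈ E := by
    intro e
    rw [SimpleGraph.edgeSet_fromEdgeSet]
    refine ⟨fun h => h.1, fun h => ⟨h, fun hd => ?_⟩⟩
    rcases h with h | h
    · exact H.not_isDiag_of_mem_edgeSet (p.edges_subset_edgeSet h) hd
    · exact H.not_isDiag_of_mem_edgeSet (q.edges_subset_edgeSet h) hd
  have hac : H'.IsAcyclic := by
    intro a c hc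
    have hcE : ∀ e ∈ c.edges, e ∈ E := fun e he => (hmem e).1 (c.edges_subset_edgeSet he)
    have hcH : ∀ e ∈ c.edges, e ∈ H.edgeSet := fun e he => (hcE e he).elim
      (fun h => p.edges_subset_edgeSet h) fun h => q.edges_subset_edgeSet h
    have h1 := hno a (c.transfer H hcH) (hc.transfer hcH)
    rw [SimpleGraph.Walk.length_transfer, ← SimpleGraph.Walk.length_edges,
      ← List.toFinset_card_of_nodup hc.edges_nodup] at h1
    have h2 : c.edges.toFinset ⊆ p.edges.toFinset ∪ q.edges.toFinset := by
      intro e he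
      rw [Finset.mem_union, List.mem_toFinset, List.mem_toFinset]
      exact hcE e (List.mem_toFinset.1 he)
    have h3 := (Finset.card_le_card h2).trans (Finset.card_union_le _ _)
    have h4 := p.edges.toFinset_card_le
    have h5 := q.edges.toFinset_card_le
    rw [SimpleGraph.Walk.length_edges] at h4 h5
    omega
  have hpH : ∀ e ∈ p.edges, e ∈ H'.edgeSet := fun e he => (hmem e).2 (.inl he)
  have hqH : ∀ e ∈ q.edges, e ∈ H'.edgeSet := fun e he => (hmem e).2 (.inr he)
  have := (SimpleGraph.isAcyclic_iff_subsingleton_path.1 hac u v).elim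
    ⟨p.transfer H' hpH, hp.transfer hpH⟩ ⟨q.transfer H' hqH, hq.transfer hqH⟩
  have h := congrArg (fun r : H'.Path u v => r.1.support) this
  simp only [SimpleGraph.Walk.support_transfer] at h
  exact SimpleGraph.Walk.ext_support h

/-- Within distance `k` of a node, every node has at most one neighbour that is not farther. -/
theorem nbr_eq_of_no_short_cycle
    (hno : ∀ (a : W) (c : H.Walk a a), c.IsCycle → 2 * k < c.length) {v w x x' : W}
    (hw : H.Reachable v w) (hx : H.Adj w x) (hx' : H.Adj w x')
    (hd : H.dist v x ≤ H.dist v w) (hd' : H.dist v x' ≤ H.dist v w)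
    (hk : H.dist v x + 1 ≤ k) (hk' : H.dist v x' + 1 ≤ k) : x = x' := by
  classical
  have key : ∀ {x : W}, H.Adj w x → H.dist v x ≤ H.dist v w → H.dist v x + 1 ≤ k →
      ∃ p : H.Walk v w, p.IsPath ∧ p.length ≤ k ∧ p.penultimate = x := by
    intro x hx hd hk
    obtain ⟨p, hp, hl⟩ := (hw.trans hx.reachable).exists_path_of_dist
    refine ⟨p.concat hx.symm, hp.concat (fun hmem => ?_) hx.symm, ?_, ?_⟩
    · have h1 := SimpleGraph.dist_le (p.takeUntil w hmem)
      have h2 := p.length_takeUntil_lt_length hmem hx.ne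
      omega
    · rw [SimpleGraph.Walk.length_concat]
      omega
    · simp
  -- both neighbours are last steps of paths from `v` to `w` of length at most `k`
  obtain ⟨p, hp, hl, rfl⟩ := key hx hd hk
  obtain ⟨q, hq, hl', rfl⟩ := key hx' hd' hk'
  rw [path_eq_of_no_short_cycle hno hp hq hl hl']

open Classical in
/-- The Moore bound: breadth-first search from `v` meets at least `d ^ j` nodes at distance
`j ≤ k`. -/
theorem pow_le_card_layer [Fintype W]
    (hno : ∀ (a : W) (c : H.Walk a a), c.IsCycle → 2 * k < c.length) {v : W} {d : ℝ} (hd : 0 ≤ d)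
    (hdeg : ∀ w, H.Reachable v w → d + 1 ≤ (Finset.univ.filter fun x => H.Adj w x).card)
    {j : ℕ} (hj : j ≤ k) :
    d ^ j ≤ (Finset.univ.filter fun w => H.Reachable v w ∧ H.dist v w = j).card := by
  let L : ℕ → Finset W := fun j => Finset.univ.filter fun w => H.Reachable v w ∧ H.dist v w = j
  have hL : ∀ {j w}, w ∈ L j ↔ H.Reachable v w ∧ H.dist v w = j := fun {j w} => by simp [L]
  change d ^ j ≤ (L j).card
  induction j with
  | zero =>
    have : v ∈ L 0 := hL.2 ⟨.refl _, SimpleGraph.dist_self⟩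
    rw [pow_zero]
    exact_mod_cast Finset.card_pos.2 ⟨v, this⟩
  | succ j ih =>
    have hup : ∀ w ∈ L j, d ≤ ((L (j + 1)).bipartiteAbove H.Adj w).card := by
      intro w hw
      obtain ⟨hr, hdw⟩ := hL.1 hw
      have hsplit : (Finset.univ.filter fun x => H.Adj w x) ⊆
          ((L (j + 1)).bipartiteAbove H.Adj w) ∪
            Finset.univ.filter fun x => H.Adj w x ∧ H.dist v x ≤ j := by
        intro x hx
        have hadj : H.Adj w x := by simpa using hx
        have h1 : H.dist v x ≤ j + 1 := by
          obtain ⟨p, hp⟩ := hr.exists_walk_length_eq_dist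
          have := SimpleGraph.dist_le (p.concat hadj)
          rw [SimpleGraph.Walk.length_concat] at this
          omega
        rw [Finset.mem_union, Finset.mem_bipartiteAbove]
        rcases h1.lt_or_eq with h1 | h1
        · exact .inr (Finset.mem_filter.2 ⟨Finset.mem_univ _, hadj, by omega⟩)
        · exact .inl ⟨hL.2 ⟨hr.trans hadj.reachable, h1⟩, hadj⟩
      have hone : (Finset.univ.filter fun x => H.Adj w x ∧ H.dist v x ≤ j).card ≤ 1 := by
        refine Finset.card_le_one.2 fun x hx x' hx' => ?_
        obtain ⟨-, hx, hxd⟩ := Finset.mem_filter.1 hx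
        obtain ⟨-, hx', hxd'⟩ := Finset.mem_filter.1 hx'
        exact nbr_eq_of_no_short_cycle hno hr hx hx' (by omega) (by omega) (by omega) (by omega)
      have h2 := (Finset.card_le_card hsplit).trans (Finset.card_union_le _ _)
      have h3 := hdeg w hr
      have h4 : ((Finset.univ.filter fun x => H.Adj w x).card : ℝ) ≤
          ((L (j + 1)).bipartiteAbove H.Adj w).card + 1 := by
        exact_mod_cast h2.trans (Nat.add_le_add_left hone _)
      linarith
    have hdown : ∀ x ∈ L (j + 1), ((L j).bipartiteBelow H.Adj x).card ≤ 1 := by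
      intro x hx
      obtain ⟨hr, hdx⟩ := hL.1 hx
      refine Finset.card_le_one.2 fun w hw w' hw' => ?_
      obtain ⟨hw, hwx⟩ := (Finset.mem_bipartiteBelow _).1 hw
      obtain ⟨hw', hwx'⟩ := (Finset.mem_bipartiteBelow _).1 hw'
      have h1 := (hL.1 hw).2
      have h2 := (hL.1 hw').2
      exact nbr_eq_of_no_short_cycle hno hr hwx.symm hwx'.symm (by omega) (by omega) (by omega)
        (by omega)
    have hcount := Finset.sum_card_bipartiteAbove_eq_sum_card_bipartiteBelow
      (s := L j) (t := L (j + 1)) H.Adj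
    calc d ^ (j + 1) = d ^ j * d := pow_succ d j
      _ ≤ (L j).card * d := mul_le_mul_of_nonneg_right (ih (by omega)) hd
      _ = ∑ w ∈ L j, d := by rw [Finset.sum_const, nsmul_eq_mul]
      _ ≤ ∑ w ∈ L j, (((L (j + 1)).bipartiteAbove H.Adj w).card : ℝ) := Finset.sum_le_sum hup
      _ = ((∑ x ∈ L (j + 1), ((L j).bipartiteBelow H.Adj x).card : ℕ) : ℝ) := by
        rw [← hcount, Nat.cast_sum]
      _ ≤ (((L (j + 1)).card : ℕ) : ℝ) := by
        refine Nat.cast_le.2 ((Finset.sum_le_sum hdown).trans ?_)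
        simp

/-- The subgraph of the edges with both ends in `s`. -/
def restrictTo (H : SimpleGraph W) (s : Finset W) : SimpleGraph W where
  Adj a b := a ∈ s ∧ b ∈ s ∧ H.Adj a b
  symm := ⟨fun _ _ h => ⟨h.2.1, h.1, h.2.2.symm⟩⟩
  loopless := ⟨fun _ h => h.2.2.ne rfl⟩

open Classical in
/-- A graph on at most `d ^ k` nodes without cycles of length at most `2 * k` has a node of degree
less than `d + 1`, in each of its induced subgraphs. -/
theorem exists_small_degree [Fintype W] (hk : 1 ≤ k)
    (hno : ∀ (a : W) (c : H.Walk a a), c.IsCycle → 2 * k < c.length) {d : ℝ} (hd : 0 ≤ d)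
    (hcard : (Fintype.card W : ℝ) ≤ d ^ k) {s : Finset W} (hs : s.Nonempty) :
    ∃ v ∈ s, ((s.filter fun x => H.Adj v x).card : ℝ) < d + 1 := by
  by_contra! hcon
  obtain ⟨v, hv⟩ := hs
  have hle : restrictTo H s ≤ H := fun a b h => h.2.2
  have hno' : ∀ (a : W) (c : (restrictTo H s).Walk a a), c.IsCycle → 2 * k < c.length := by
    intro a c hc
    have := hno a (c.mapLe hle) (hc.mapLe hle)
    simpa using this
  have hreach : ∀ w, (restrictTo H s).Reachable v w → w ∈ s := by
    rintro w ⟨p⟩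
    cases p.reverse with
    | nil => exact hv
    | cons h _ => exact h.1
  have := pow_le_card_layer hno' hd (v := v) (fun w hw => ?_) (le_refl k)
  · have hlt : (Finset.univ.filter fun w =>
        (restrictTo H s).Reachable v w ∧ (restrictTo H s).dist v w = k).card < Fintype.card W := by
      refine Finset.card_lt_univ_of_notMem (x := v) fun h => ?_
      have := (Finset.mem_filter.1 h).2.2
      rw [SimpleGraph.dist_self] at this
      omega
    have hlt' : ((Finset.univ.filter fun w => (restrictTo H s).Reachable v w ∧
        (restrictTo H s).dist v w = k).card : ℝ) < Fintype.card W := by exact_mod_cast hlt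
    linarith
  · have hws := hreach w hw
    refine (hcon w hws).trans (Nat.cast_le.2 (Finset.card_le_card fun x hx => ?_))
    obtain ⟨hx, hadj⟩ := Finset.mem_filter.1 hx
    exact Finset.mem_filter.2 ⟨Finset.mem_univ _, hws, hx, hadj⟩

open Classical in
/-- A graph without short cycles has at most `(d + 1) * |s|` edges inside `s`, as nodes of degree
less than `d + 1` can be removed one by one. Ordered pairs count every edge twice. -/
theorem card_adj_pairs_le [Fintype W] (hk : 1 ≤ k)
    (hno : ∀ (a : W) (c : H.Walk a a), c.IsCycle → 2 * k < c.length) {d : ℝ} (hd : 0 ≤ d)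
    (hcard : (Fintype.card W : ℝ) ≤ d ^ k) (s : Finset W) :
    (((s ×ˢ s).filter fun p => H.Adj p.1 p.2).card : ℝ) ≤ 2 * (d + 1) * s.card := by
  induction hc : s.card generalizing s with
  | zero => simp [Finset.card_eq_zero.1 hc]
  | succ m ih =>
    obtain ⟨v, hv, hdeg⟩ := exists_small_degree hk hno hd hcard
      (Finset.card_pos.1 (by omega : 0 < s.card))
    have h1 := ih (s.erase v) (by rw [Finset.card_erase_of_mem hv]; omega)
    have hsub : ((s ×ˢ s).filter fun p => H.Adj p.1 p.2) ⊆
        (((s.erase v) ×ˢ (s.erase v)).filter fun p => H.Adj p.1 p.2) ∪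
          ((s.filter fun x => H.Adj v x).image (fun x => (v, x)) ∪
            (s.filter fun x => H.Adj v x).image fun x => (x, v)) := by
      rintro ⟨a, b⟩ h
      simp only [Finset.mem_filter, Finset.mem_product] at h
      obtain ⟨⟨ha, hb⟩, hab⟩ := h
      simp only [Finset.mem_union, Finset.mem_filter, Finset.mem_product, Finset.mem_erase,
        Finset.mem_image, Prod.mk.injEq]
      by_cases hav : a = v
      · subst hav
        exact .inr (.inl ⟨b, ⟨hb, hab⟩, rfl, rfl⟩)
      by_cases hbv : b = v
      · subst hbv
        exact .inr (.inr ⟨a, ⟨ha, hab.symm⟩, rfl, rfl⟩)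
      exact .inl ⟨⟨⟨hav, ha⟩, hbv, hb⟩, hab⟩
    have h2 := (Finset.card_le_card hsub).trans ((Finset.card_union_le _ _).trans
      (Nat.add_le_add_left ((Finset.card_union_le _ _).trans
        (Nat.add_le_add Finset.card_image_le Finset.card_image_le)) _))
    have h3 : (((s ×ˢ s).filter fun p => H.Adj p.1 p.2).card : ℝ) ≤
        (((s.erase v) ×ˢ (s.erase v)).filter fun p => H.Adj p.1 p.2).card +
          ((s.filter fun x => H.Adj v x).card + (s.filter fun x => H.Adj v x).card) := by
      exact_mod_cast h2
    push_cast
    linarith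

/-- Any cycle of length at most `2 * k` has lost its heaviest edge. -/
theorem sparsify_no_short_cycle {ident : W → ℕ} (a : W) (c : (sparsify H ident k).Walk a a)
    (hc : c.IsCycle) : 2 * k < c.length := by
  classical
  by_contra! hlen
  have hle : sparsify H ident k ≤ H := SimpleGraph.deleteEdges_le _
  have hne : c.edges ≠ [] := by
    intro h
    have := hc.three_le_length
    rw [← SimpleGraph.Walk.length_edges, h] at this
    simp at this
  obtain ⟨e, he, hmax⟩ := c.edges.toFinset.exists_max_image (edgeWeight ident)
    (List.toFinset_nonempty_iff _ |>.2 hne)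
  have he' : e ∈ c.edges := List.mem_toFinset.1 he
  have hdel := c.edges_subset_edgeSet he'
  rw [sparsify, SimpleGraph.edgeSet_deleteEdges] at hdel
  refine hdel.2 ⟨a, c.mapLe hle, hc.mapLe hle, by simpa using hlen, by simpa using he', ?_⟩
  intro f hf
  exact hmax f (List.mem_toFinset.2 (by simpa using hf))

end girth

/-- By the Moore bound with `d = n ^ (1 / k)`, the sparse subgraph has at most `(d + 1) * |D|`
edges, and each of them adds at most `4` nodes for each of its two orientations. -/
theorem card_connectDS_le {V : Type*} [Fintype V] {G : SimpleGraph V} {ident : V → ℕ}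
    (hinj : Function.Injective ident) {k n : ℕ} (hk : 1 ≤ k) (hn : Fintype.card V = n)
    (D : Finset V) :
    ((connectDS G ident k D).card : ℝ) ≤
      (1 + 8 * ((n : ℝ) ^ ((1 : ℝ) / k) + 1)) * D.card := by
  classical
  set S := sparsify (domGraph G D) (fun w => ident w.1) k with hS
  set d : ℝ := (n : ℝ) ^ ((1 : ℝ) / k) with hd
  have hd0 : 0 ≤ d := Real.rpow_nonneg (Nat.cast_nonneg n) _
  have hdk : d ^ k = n := by
    rw [hd, ← Real.rpow_natCast, ← Real.rpow_mul (Nat.cast_nonneg n),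
      one_div_mul_cancel (by exact_mod_cast (by omega : k ≠ 0)), Real.rpow_one]
  have hcard : (Fintype.card {v // v ∈ D} : ℝ) ≤ d ^ k := by
    rw [hdk, Fintype.card_coe, ← hn]
    exact_mod_cast Finset.card_le_univ D
  have hpairs := card_adj_pairs_le hk (sparsify_no_short_cycle (H := domGraph G D)
    (ident := fun w => ident w.1) (k := k)) hd0 hcard Finset.univ
  set P := ((Finset.univ ×ˢ Finset.univ).filter
    fun p : {v // v ∈ D} × {v // v ∈ D} => S.Adj p.1 p.2) with hP
  rw [Finset.card_univ, Fintype.card_coe] at hpairs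
  let B : {v // v ∈ D} × {v // v ∈ D} → Finset V := fun p =>
    Finset.univ.filter fun x => ident x ∈ shortestPath G ident p.1.1 p.2.1
  have hB : ∀ p ∈ P, (B p).card ≤ 4 := by
    intro p hp
    have hadj : (domGraph G D).Adj p.1 p.2 :=
      SimpleGraph.deleteEdges_le _ (Finset.mem_filter.1 hp).2
    have he : G.edist p.1.1 p.2.1 ≤ ((3 : ℕ) : ℕ∞) := hadj.2
    obtain ⟨w, hw, heq⟩ := exists_walk_of_mem_shortestPath (ident := ident)
      (SimpleGraph.reachable_of_edist_ne_top (ne_top_of_le_ne_top (ENat.natCast_ne_top 3) he))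
    have hlen : w.length ≤ 3 := hw.trans_le (dist_le_of_edist_le he)
    have hsub : B p ⊆ w.support.toFinset := by
      intro x hx
      have := (Finset.mem_filter.1 hx).2
      rw [heq, List.mem_map_of_injective hinj] at this
      exact List.mem_toFinset.2 this
    have h1 := (Finset.card_le_card hsub).trans w.support.toFinset_card_le
    rw [SimpleGraph.Walk.length_support] at h1
    omega
  have hsub : connectDS G ident k D ⊆ D ∪ P.biUnion B := by
    intro x hx
    rw [connectDS, Finset.mem_union, Finset.mem_filter] at hx
    rcases hx with hx | ⟨-, u, v, hadj, -, hx⟩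
    · exact Finset.mem_union_left _ hx
    · refine Finset.mem_union_right _ (Finset.mem_biUnion.2 ⟨(u, v), ?_, ?_⟩)
      · exact Finset.mem_filter.2 ⟨by simp, hadj⟩
      · exact Finset.mem_filter.2 ⟨Finset.mem_univ _, hx⟩
  have h1 := (Finset.card_le_card hsub).trans ((Finset.card_union_le _ _).trans
    (Nat.add_le_add_left (Finset.card_biUnion_le_card_mul P B 4 hB) _))
  have h2 : ((connectDS G ident k D).card : ℝ) ≤ D.card + P.card * 4 := by exact_mod_cast h1
  linarith

/-! ### Radii and the probability of being clustered -/

open MeasureTheory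

section radius

variable {n k : ℕ} {α : ℝ}

theorem decay_mem_Icc (hn : 1 ≤ n) (hα : 0 ≤ α) :
    0 ≤ (n : ℝ) ^ (-α / (k : ℝ)) ∧ (n : ℝ) ^ (-α / (k : ℝ)) ≤ 1 := by
  refine ⟨Real.rpow_nonneg (Nat.cast_nonneg n) _, ?_⟩
  refine Real.rpow_le_one_of_one_le_of_nonpos (by exact_mod_cast hn) ?_
  exact div_nonpos_of_nonpos_of_nonneg (by linarith) (Nat.cast_nonneg k)

theorem le_radius_iff (hn : 1 ≤ n) (hα : 0 ≤ α) {u : unitInterval} {j : ℕ} (hj : j ≤ k) :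
    j ≤ radius n k α u ↔ (u : ℝ) ≤ ((n : ℝ) ^ (-α / (k : ℝ))) ^ j := by
  classical
  obtain ⟨h0, h1⟩ := decay_mem_Icc (k := k) hn hα
  constructor
  · intro h
    have hs : (u : ℝ) ≤ ((n : ℝ) ^ (-α / (k : ℝ))) ^ radius n k α u :=
      Nat.findGreatest_spec (P := fun j => (u : ℝ) ≤ ((n : ℝ) ^ (-α / (k : ℝ))) ^ j)
        (Nat.zero_le k) (by simpa using u.2.2)
    exact hs.trans (pow_le_pow_of_le_one h0 h1 h)
  · exact fun h => Nat.le_findGreatest hj h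

theorem measurable_radius : Measurable (radius n k α) := by
  classical
  refine measurable_findGreatest fun j _ => ?_
  exact measurableSet_le measurable_subtype_coe measurable_const

theorem volume_le_radius (hn : 1 ≤ n) (hα : 0 ≤ α) {j : ℕ} (hj : j ≤ k) :
    volume.real {u : unitInterval | j ≤ radius n k α u} = ((n : ℝ) ^ (-α / (k : ℝ))) ^ j := by
  obtain ⟨h0, h1⟩ := decay_mem_Icc (k := k) hn hα
  have h2 : 0 ≤ ((n : ℝ) ^ (-α / (k : ℝ))) ^ j := pow_nonneg h0 j
  have h3 : ((n : ℝ) ^ (-α / (k : ℝ))) ^ j ≤ 1 := pow_le_one₀ h0 h1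
  have : {u : unitInterval | j ≤ radius n k α u} =
      Set.Iic ⟨((n : ℝ) ^ (-α / (k : ℝ))) ^ j, h2, h3⟩ := by
    ext u
    simp only [Set.mem_ofPred_eq, le_radius_iff hn hα hj, Set.mem_Iic, ← Subtype.coe_le_coe]
  rw [this, measureReal_def, unitInterval.volume_Iic, ENNReal.toReal_ofReal h2]

end radius

theorem exists_isLeader {V : Type*} [Finite V] (H : SimpleGraph V) (ident r : V → ℕ) (v : V) :
    ∃ y, IsLeader H ident r y v := by
  classical
  have := Fintype.ofFinite V
  obtain ⟨y, hy, hmax⟩ := (Finset.univ.filter fun z => H.edist v z ≤ r z).exists_max_image ident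
    ⟨v, by simp⟩
  exact ⟨y, (Finset.mem_filter.1 hy).2,
    fun z hz => hmax z (Finset.mem_filter.2 ⟨Finset.mem_univ z, hz⟩)⟩

/-- Linial–Saks: with radii of the truncated geometric distribution with parameter `p`, a node
joins a cluster with probability at least `p * (1 - n * p ^ k)`. Whether `y` can be the leader of
`v` depends on the radii of the nodes with larger identifiers and is independent of the radius of
`y`; the latter exceeds the distance to `v`, given that it reaches it, with probability `p`, unless
that distance is `k`. -/
theorem le_volume_clustered {V : Type*} [Fintype V] (H : SimpleGraph V) {ident : V → ℕ}
    (hinj : Function.Injective ident) {ρ : unitInterval → ℕ} (hρ : Measurable ρ) {k : ℕ}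
    (hk : ∀ u, ρ u ≤ k) {p : ℝ} (hp0 : 0 ≤ p)
    (hp : ∀ j ≤ k, volume.real {u | j ≤ ρ u} = p ^ j) (v : V) :
    p * (1 - Fintype.card V * p ^ k) ≤ volume.real
      {ω : V → unitInterval | ∃ y, v ∈ lsCluster H ident (fun z => ρ (ω z)) y} := by
  classical
  -- `E y c`: the radius of `y` is at least `c`, and no node of larger identifier reaches `v`
  let box : V → ℕ → V → Set unitInterval := fun y c z =>
    if z = y then {u | c ≤ ρ u} else
      if ident y < ident z then {u | ¬H.edist v z ≤ ρ u} else Set.univ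
  let E : V → ℕ → Set (V → unitInterval) := fun y c => Set.univ.pi (box y c)
  have hE : ∀ y c ω, ω ∈ E y c ↔
      c ≤ ρ (ω y) ∧ ∀ z, ident y < ident z → ¬H.edist v z ≤ ρ (ω z) := by
    intro y c ω
    simp only [E, Set.mem_pi, Set.mem_univ, true_implies, box]
    constructor
    · intro h
      refine ⟨by simpa using h y, fun z hz => ?_⟩
      have := h z
      rw [if_neg (fun h => by rw [h] at hz; exact hz.false), if_pos hz] at this
      exact this
    · rintro ⟨h1, h2⟩ z
      split_ifs with hzy hz
      · rw [hzy]; exact h1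
      · exact h2 z hz
      · trivial
  have hmeas : ∀ y c, MeasurableSet (E y c) := by
    intro y c
    refine MeasurableSet.univ_pi fun z => ?_
    simp only [box]
    split_ifs
    · exact hρ (measurableSet_Ici (a := c))
    · exact hρ (show MeasurableSet {m : ℕ | ¬H.edist v z ≤ (m : ℕ∞)} from .of_discrete)
    · exact .univ
  let B : V → ℝ := fun y => ∏ z ∈ Finset.univ.erase y, volume.real (box y 0 z)
  have hB1 : ∀ y, B y ≤ 1 := fun y =>
    Finset.prod_le_one (fun _ _ => measureReal_nonneg) fun _ _ => measureReal_le_one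
  have hvol : ∀ y c, c ≤ k → volume.real (E y c) = p ^ c * B y := by
    intro y c hc
    rw [measureReal_def, volume_pi_pi, ENNReal.toReal_prod,
      ← Finset.mul_prod_erase _ _ (Finset.mem_univ y)]
    congr 1
    · simp only [box, if_true]
      exact hp c hc
    · refine Finset.prod_congr rfl fun z hz => ?_
      simp only [box, if_neg (Finset.ne_of_mem_erase hz)]
      rfl
  let d : V → ℕ := fun y => (H.edist v y).toNat
  have hd : ∀ y (c : ℕ), H.edist v y ≤ c → H.edist v y = d y := fun y c h =>
    (ENat.natCast_toNat (ne_top_of_le_ne_top (ENat.natCast_ne_top c) h)).symm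
  let Y : Finset V := Finset.univ.filter fun y => H.edist v y < k
  let Z : Finset V := Finset.univ.filter fun y => H.edist v y = k
  have hYd : ∀ y ∈ Y, H.edist v y = d y ∧ d y < k := by
    intro y hy
    have h := (Finset.mem_filter.1 hy).2
    have h' := hd y k h.le
    rw [h'] at h
    exact ⟨h', by exact_mod_cast h⟩
  -- some node is the leader of `v`; the leaders at distance exactly `k` are lost
  have hcover : (Set.univ : Set (V → unitInterval)) ⊆ ⋃ y ∈ Y ∪ Z, E y (d y) := by
    intro ω _
    obtain ⟨y, hy, hmax⟩ := exists_isLeader H ident (fun z => ρ (ω z)) v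
    have hyd := hd y _ hy
    refine Set.mem_biUnion (x := y) ?_ ((hE _ _ _).2 ⟨?_, fun z hz hz' => ?_⟩)
    · have hle : H.edist v y ≤ k := hy.trans (by exact_mod_cast hk _)
      rcases hle.lt_or_eq with h | h
      · exact Finset.mem_union_left _ (Finset.mem_filter.2 ⟨Finset.mem_univ _, h⟩)
      · exact Finset.mem_union_right _ (Finset.mem_filter.2 ⟨Finset.mem_univ _, h⟩)
    · rw [hyd] at hy
      exact_mod_cast hy
    · exact absurd (hmax z hz') (not_le.2 hz)
  have h1 : 1 ≤ ∑ y ∈ Y, p ^ d y * B y + Fintype.card V * p ^ k := by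
    calc (1 : ℝ) = volume.real (Set.univ : Set (V → unitInterval)) := by simp
      _ ≤ volume.real (⋃ y ∈ Y ∪ Z, E y (d y)) := measureReal_mono hcover (measure_ne_top _ _)
      _ ≤ ∑ y ∈ Y ∪ Z, volume.real (E y (d y)) := measureReal_biUnion_finset_le _ _
      _ = ∑ y ∈ Y, volume.real (E y (d y)) + ∑ y ∈ Z, volume.real (E y (d y)) := by
        refine Finset.sum_union (Finset.disjoint_left.2 fun y hy hz => ?_)
        have h := (Finset.mem_filter.1 hy).2
        rw [(Finset.mem_filter.1 hz).2] at h
        exact h.false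
      _ ≤ _ := by
        refine add_le_add (Finset.sum_le_sum fun y hy => (hvol y _ (hYd y hy).2.le).le) ?_
        calc ∑ y ∈ Z, volume.real (E y (d y)) ≤ ∑ y ∈ Z, p ^ k := by
              refine Finset.sum_le_sum fun y hy => ?_
              have hy' := (Finset.mem_filter.1 hy).2
              have hdk : d y = k := by simp [d, hy']
              rw [hdk, hvol y k le_rfl]
              exact mul_le_of_le_one_right (pow_nonneg hp0 k) (hB1 y)
          _ = Z.card * p ^ k := by rw [Finset.sum_const, nsmul_eq_mul]
          _ ≤ _ := mul_le_mul_of_nonneg_right (by exact_mod_cast Finset.card_le_univ Z)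
            (pow_nonneg hp0 k)
  -- one more unit of radius puts `v` strictly inside, at the cost of a factor `p`
  have hsub : (⋃ y ∈ Y, E y (d y + 1)) ⊆
      {ω : V → unitInterval | ∃ y, v ∈ lsCluster H ident (fun z => ρ (ω z)) y} := by
    intro ω hω
    obtain ⟨y, hy, hω⟩ := Set.mem_iUnion₂.1 hω
    obtain ⟨h2, h3⟩ := (hE _ _ _).1 hω
    have hlt : H.edist v y < ρ (ω y) := by
      rw [(hYd y hy).1]
      exact_mod_cast h2
    exact ⟨y, mem_lsCluster_iff.2
      ⟨⟨hlt.le, fun z hz => not_lt.1 fun h => h3 z h hz⟩, hlt⟩⟩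
  have hdisj : Set.PairwiseDisjoint (Y : Set V) fun y => E y (d y + 1) := by
    intro y hy y' hy' hne
    refine Set.disjoint_left.2 fun ω hω hω' => hne ?_
    have key : ∀ {y y' : V}, y ∈ Y → ω ∈ E y (d y + 1) → ω ∈ E y' (d y' + 1) →
        ident y ≤ ident y' := by
      intro y y' hy hω hω'
      refine not_lt.1 fun h => ((hE _ _ _).1 hω').2 y h ?_
      rw [(hYd y hy).1]
      exact_mod_cast (Nat.le_succ _).trans ((hE _ _ _).1 hω).1
    exact hinj (le_antisymm (key hy hω hω') (key hy' hω' hω))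
  calc p * (1 - Fintype.card V * p ^ k) ≤ p * ∑ y ∈ Y, p ^ d y * B y :=
        mul_le_mul_of_nonneg_left (by linarith) hp0
    _ = ∑ y ∈ Y, volume.real (E y (d y + 1)) := by
      rw [Finset.mul_sum]
      refine Finset.sum_congr rfl fun y hy => ?_
      rw [hvol y _ (hYd y hy).2, pow_succ]
      ring
    _ = volume.real (⋃ y ∈ Y, E y (d y + 1)) :=
      (measureReal_biUnion_finset hdisj fun y _ => hmeas y _).symm
    _ ≤ _ := measureReal_mono hsub

/-! ### A lower tail bound for independent trials -/

theorem exp_neg_le_quadratic {x : ℝ} (hx : 0 ≤ x) : Real.exp (-x) ≤ 1 - x + x ^ 2 / 2 := by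
  have h := Real.quadratic_le_exp_of_nonneg hx
  have h1 : 0 ≤ 1 - x + x ^ 2 / 2 := by nlinarith [sq_nonneg (x - 1)]
  have h2 : 1 ≤ (1 - x + x ^ 2 / 2) * Real.exp x :=
    calc (1 : ℝ) ≤ (1 - x + x ^ 2 / 2) * (1 + x + x ^ 2 / 2) := by nlinarith [sq_nonneg (x ^ 2)]
      _ ≤ _ := mul_le_mul_of_nonneg_left h h1
  rw [Real.exp_neg, inv_eq_one_div, div_le_iff₀ (Real.exp_pos x)]
  exact h2

/-- The Chernoff bound `P (X < (1 - ε) * q * ℓ) ≤ exp (-ε ^ 2 * q * ℓ / 2)` for the number `X` of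
successes in `ℓ` independent trials of success probability at least `q`: Markov's inequality for
`exp (-ε * X)`. -/
theorem volume_few_successes_le {X : Type*} [MeasureSpace X]
    [IsProbabilityMeasure (volume : Measure X)] {E : Set X} [DecidablePred (· ∈ E)]
    (hE : MeasurableSet E) {q ε : ℝ} (hq0 : 0 ≤ q) (hq : q ≤ volume.real E) (hε : 0 ≤ ε) (ℓ : ℕ) :
    volume.real {ω : Fin ℓ → X | ((Finset.univ.filter fun t => ω t ∈ E).card : ℝ) <
      (1 - ε) * (q * ℓ)} ≤ Real.exp (-(ε ^ 2 * (q * ℓ)) / 2) := by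
  have he1 : Real.exp (-ε) ≤ 1 := Real.exp_le_one_iff.2 (by linarith)
  let g : X → ℝ := fun x => 1 - E.indicator (fun _ => 1 - Real.exp (-ε)) x
  have hg : ∀ x, g x = if x ∈ E then Real.exp (-ε) else 1 := by
    intro x
    by_cases h : x ∈ E <;> simp [g, h]
  have hgm : Measurable g := measurable_const.sub (measurable_const.indicator hE)
  have hg0 : ∀ x, 0 ≤ g x := fun x => by rw [hg]; split_ifs <;> positivity
  have hg1 : ∀ x, g x ≤ 1 := fun x => by rw [hg]; split_ifs; exacts [he1, le_rfl]
  have hgi : ∫ x, g x = 1 - volume.real E * (1 - Real.exp (-ε)) := by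
    rw [integral_sub (integrable_const _) ((integrable_const _).indicator hE),
      integral_indicator hE]
    simp
  let f : (Fin ℓ → X) → ℝ := fun ω => ∏ t, g (ω t)
  have hf : ∀ ω, f ω =
      Real.exp (-ε * ((Finset.univ.filter fun t => ω t ∈ E).card : ℝ)) := by
    intro ω
    simp only [f, hg, Finset.prod_ite, Finset.prod_const, one_pow, mul_one]
    rw [← Real.exp_nat_mul]
    congr 1
    ring
  have hfm : Measurable f := Finset.measurable_fun_prod _ fun t _ =>
    hgm.comp (measurable_pi_apply t)
  have hf0 : ∀ ω, 0 ≤ f ω := fun ω => Finset.prod_nonneg fun t _ => hg0 _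
  have hfint : Integrable f := by
    refine Integrable.of_bound hfm.aestronglyMeasurable 1 (.of_forall fun ω => ?_)
    rw [Real.norm_of_nonneg (hf0 ω)]
    exact Finset.prod_le_one (fun t _ => hg0 _) fun t _ => hg1 _
  have hfi : ∫ ω, f ω ≤ Real.exp (-(q * (1 - Real.exp (-ε)))) ^ ℓ := by
    have h1 : ∫ ω, f ω = (∫ x, g x) ^ ℓ := by
      have := integral_fintype_prod_volume_eq_prod (ι := Fin ℓ) fun _ => g
      simpa using this
    rw [h1]
    refine pow_le_pow_left₀ (integral_nonneg hg0) ?_ ℓ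
    rw [hgi]
    have h2 : q * (1 - Real.exp (-ε)) ≤ volume.real E * (1 - Real.exp (-ε)) :=
      mul_le_mul_of_nonneg_right hq (by linarith)
    have h3 := Real.add_one_le_exp (-(q * (1 - Real.exp (-ε))))
    linarith
  set b : ℝ := Real.exp (-ε * ((1 - ε) * (q * ℓ))) with hb
  have hsub : {ω : Fin ℓ → X | ((Finset.univ.filter fun t => ω t ∈ E).card : ℝ) <
      (1 - ε) * (q * ℓ)} ⊆ {ω | b ≤ f ω} := by
    intro ω hω
    simp only [Set.mem_ofPred_eq] at hω ⊢
    rw [hf, hb]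
    refine Real.exp_le_exp.2 ?_
    nlinarith
  have hmarkov := mul_meas_ge_le_integral_of_nonneg (.of_forall hf0) hfint b
  have hle : b * volume.real {ω : Fin ℓ → X |
      ((Finset.univ.filter fun t => ω t ∈ E).card : ℝ) < (1 - ε) * (q * ℓ)} ≤
      Real.exp (-(q * (1 - Real.exp (-ε)))) ^ ℓ :=
    (mul_le_mul_of_nonneg_left (measureReal_mono hsub (measure_ne_top _ _))
      (Real.exp_pos _).le).trans (hmarkov.trans hfi)
  rw [← le_div_iff₀' (Real.exp_pos _)] at hle
  refine hle.trans ?_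
  rw [← Real.exp_nat_mul, ← Real.exp_sub]
  refine Real.exp_le_exp.2 ?_
  have h4 := exp_neg_le_quadratic hε
  have h5 : 0 ≤ q * ℓ := mul_nonneg hq0 (Nat.cast_nonneg ℓ)
  nlinarith [mul_le_mul_of_nonneg_left h4 h5]

/-! ### Exchanging nodes and instances -/

/-- Both sides give the same measure to boxes. -/
theorem measurePreserving_swap (ι κ X : Type*) [Fintype ι] [Fintype κ] [MeasureSpace X]
    [IsProbabilityMeasure (volume : Measure X)] :
    MeasurePreserving (fun (f : ι → κ → X) (j : κ) (i : ι) => f i j) volume volume := by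
  have hm : Measurable (fun (f : ι → κ → X) (j : κ) (i : ι) => f i j) := by fun_prop
  refine ⟨hm, ?_⟩
  symm
  refine Measure.pi_eq_generateFrom
    (C := fun _ => Set.pi Set.univ '' Set.pi Set.univ fun _ => {s | MeasurableSet s})
    (fun _ => generateFrom_pi) (fun _ => isPiSystem_pi)
    (fun _ => Measure.FiniteSpanningSetsIn.pi fun _ => volume.toFiniteSpanningSetsIn) ?_
  intro s hs
  choose B hB hBs using hs
  have hBm : ∀ j i, MeasurableSet (B j i) := fun j i => hB j i (Set.mem_univ i)
  obtain rfl : (fun j => Set.univ.pi (B j)) = s := funext hBs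
  rw [Measure.map_apply hm (MeasurableSet.univ_pi fun j => MeasurableSet.univ_pi (hBm j))]
  have : (fun (f : ι → κ → X) (j : κ) (i : ι) => f i j) ⁻¹'
      (Set.univ.pi fun j => Set.univ.pi (B j)) =
      Set.univ.pi fun i => Set.univ.pi fun j => B j i := by
    ext f
    simp only [Set.mem_preimage, Set.mem_pi, Set.mem_univ, true_implies]
    exact forall_comm
  rw [this, volume_pi_pi]
  simp only [volume_pi_pi, Measure.pi_pi]
  exact Finset.prod_comm (f := fun i j => volume (B j i))

/-- The random choices, regrouped into the radii of all nodes by instance, and the coins. -/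
def regroup {V : Type*} {ℓ : ℕ} (ω : V → Seed ℓ) :
    (Fin ℓ → V → unitInterval) × (V → unitInterval) :=
  (fun t v => (ω v).1 t, fun v => (ω v).2)

theorem measurePreserving_regroup {V : Type*} [Fintype V] {ℓ : ℕ} :
    MeasurePreserving (regroup : (V → Seed ℓ) → _) volume volume :=
  ((measurePreserving_swap V (Fin ℓ) unitInterval).prod (MeasurePreserving.id volume)).comp
    (volume_measurePreserving_arrowProdEquivProdArrow (Fin ℓ → unitInterval) unitInterval V)

/-! ### The fractional dominating set -/

section frac

variable {V : Type*} [Fintype V] {G : SimpleGraph V} {ident : V → ℕ} {ℓ : ℕ} {r : Fin ℓ → V → ℕ}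

open Classical in
/-- The number of instances in which `j` joins a cluster. -/
noncomputable def clusterCount (G : SimpleGraph V) (ident : V → ℕ) (r : Fin ℓ → V → ℕ) (j : V) :
    ℕ :=
  (Finset.univ.filter fun t => ∃ y, j ∈ lsCluster (lsGraph G) ident (r t) y).card

theorem lpSum_nonneg (i : V) : 0 ≤ lpSum G ident r i :=
  Finset.sum_nonneg fun _ _ => Finset.sum_nonneg fun _ _ => lpSolution_nonneg _ _

theorem clusterCount_le_sum_lpSum (hinj : Function.Injective ident) (j : V) :
    (clusterCount G ident r j : ℝ) ≤ ∑ i ∈ closedNbr G j, lpSum G ident r i := by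
  classical
  simp only [lpSum]
  rw [Finset.sum_comm, clusterCount, Finset.card_filter, Nat.cast_sum]
  refine Finset.sum_le_sum fun t _ => ?_
  rw [Finset.sum_comm]
  have hnn : ∀ y, 0 ≤ ∑ i ∈ closedNbr G j,
      lpSolution (clusterLP G ident (lsCluster (lsGraph G) ident (r t) y)) (ident i) :=
    fun y => Finset.sum_nonneg fun _ _ => lpSolution_nonneg _ _
  split_ifs with h
  · obtain ⟨y, hy⟩ := h
    rw [Nat.cast_one]
    exact (one_le_sum_lpSolution hinj hy).trans
      (Finset.single_le_sum (fun y _ => hnn y) (Finset.mem_univ y))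
  · rw [Nat.cast_zero]
    exact Finset.sum_nonneg fun y _ => hnn y

theorem sum_lpSum_le (hinj : Function.Injective ident) {D : Finset V} (hD : IsDominating G D) :
    ∑ i, lpSum G ident r i ≤ ℓ * D.card := by
  simp only [lpSum]
  rw [Finset.sum_comm]
  calc _ ≤ ∑ _t : Fin ℓ, (D.card : ℝ) :=
        Finset.sum_le_sum fun t _ => sum_lpSolution_le hinj (r t) hD
    _ = ℓ * D.card := by simp

theorem fracDS_nonneg (i : V) : 0 ≤ fracDS G ident r i :=
  div_nonneg (lpSum_nonneg i) (Finset.le_inf' _ _ fun _ _ =>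
    Finset.sum_nonneg fun _ _ => lpSum_nonneg _)

/-- A variable is divided by sums in which it occurs. -/
theorem fracDS_le_one (i : V) : fracDS G ident r i ≤ 1 := by
  refine div_le_one_of_le₀ (Finset.le_inf' _ _ fun j hj => ?_) (Finset.le_inf' _ _ fun _ _ =>
    Finset.sum_nonneg fun _ _ => lpSum_nonneg _)
  exact Finset.single_le_sum (f := lpSum G ident r) (fun _ _ => lpSum_nonneg _)
    (mem_closedNbr_comm.1 hj)

variable {m : ℝ}

theorem fracDS_le_div (hm : 0 < m) (h : ∀ j, m ≤ ∑ i ∈ closedNbr G j, lpSum G ident r i) (i : V) :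
    fracDS G ident r i ≤ lpSum G ident r i / m :=
  div_le_div_of_nonneg_left (lpSum_nonneg i) hm (Finset.le_inf' _ _ fun j _ => h j)

theorem one_le_sum_fracDS (hm : 0 < m) (h : ∀ j, m ≤ ∑ i ∈ closedNbr G j, lpSum G ident r i)
    (j : V) : 1 ≤ ∑ i ∈ closedNbr G j, fracDS G ident r i := by
  have hj : 0 < ∑ i ∈ closedNbr G j, lpSum G ident r i := hm.trans_le (h j)
  calc (1 : ℝ) = ∑ i ∈ closedNbr G j,
        lpSum G ident r i / ∑ i ∈ closedNbr G j, lpSum G ident r i := by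
        rw [← Finset.sum_div, div_self hj.ne']
    _ ≤ _ := by
      refine Finset.sum_le_sum fun i hi => ?_
      refine div_le_div_of_nonneg_left (lpSum_nonneg i) ?_
        (Finset.inf'_le _ (mem_closedNbr_comm.1 hi))
      exact hm.trans_le (Finset.le_inf' _ _ fun j _ => h j)

end frac

/-! ### Randomized rounding -/

section rounding

variable {V : Type*} [Fintype V] {G : SimpleGraph V} {Δ : ℕ} {lam : ℝ}

theorem measurable_roundVar (x : ℝ) : Measurable (roundVar Δ lam x) := by
  unfold roundVar
  refine Measurable.ite (.const _) measurable_const (Measurable.ite ?_ measurable_const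
    measurable_const)
  exact measurableSet_lt measurable_subtype_coe measurable_const

theorem roundVar_le_one {x : ℝ} (hx : x ≤ 1) (c : unitInterval) : roundVar Δ lam x c ≤ 1 := by
  unfold roundVar
  split_ifs
  · exact Nat.ceil_le.2 (by simpa using hx)
  · exact le_rfl
  · exact zero_le_one

theorem volume_coe_lt {a : ℝ} (h0 : 0 ≤ a) (h1 : a ≤ 1) :
    volume.real {c : unitInterval | (c : ℝ) < a} = a := by
  have : {c : unitInterval | (c : ℝ) < a} = Set.Iio ⟨a, h0, h1⟩ := by
    ext c
    simp [← Subtype.coe_lt_coe]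
  rw [this, measureReal_def, unitInterval.volume_Iio, ENNReal.toReal_ofReal h0]

theorem integral_roundVar_le {x : ℝ} (h0 : 0 ≤ x) (h1 : x ≤ 1)
    (hL : 0 ≤ lam * Real.log ((Δ : ℝ) + 1)) :
    ∫ c, (roundVar Δ lam x c : ℝ) ≤ x * (lam * Real.log ((Δ : ℝ) + 1)) := by
  by_cases h : 1 ≤ x * (lam * Real.log ((Δ : ℝ) + 1))
  · have hb : ∀ c, (roundVar Δ lam x c : ℝ) ≤ 1 := fun c => by exact_mod_cast roundVar_le_one h1 c
    calc _ ≤ ∫ _ : unitInterval, (1 : ℝ) := by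
          refine integral_mono_of_nonneg (.of_forall fun c => Nat.cast_nonneg _)
            (integrable_const _) (.of_forall hb)
      _ = 1 := by simp
      _ ≤ _ := h
  · have : ∀ c : unitInterval, (roundVar Δ lam x c : ℝ) =
        {c : unitInterval | (c : ℝ) < x * (lam * Real.log ((Δ : ℝ) + 1))}.indicator
          (fun _ => (1 : ℝ)) c := by
      intro c
      rw [roundVar, if_neg h, Set.indicator_apply]
      simp only [Set.mem_ofPred_eq]
      split_ifs <;> simp
    simp only [this]
    rw [integral_indicator (measurableSet_lt measurable_subtype_coe measurable_const)]
    simp only [integral_const, smul_eq_mul, mul_one, measureReal_restrict_apply_univ]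
    rw [volume_coe_lt (mul_nonneg h0 hL) (not_le.1 h).le]

theorem volume_roundVar_eq_zero_le {x : ℝ} (h0 : 0 ≤ x)
    (hL : 0 ≤ lam * Real.log ((Δ : ℝ) + 1)) :
    volume.real {c | roundVar Δ lam x c = 0} ≤
      Real.exp (-(x * (lam * Real.log ((Δ : ℝ) + 1)))) := by
  by_cases h : 1 ≤ x * (lam * Real.log ((Δ : ℝ) + 1))
  · have hx : 0 < x := by
      refine h0.lt_of_ne fun hx => ?_
      rw [← hx, zero_mul] at h
      exact absurd h (by norm_num)
    have : {c | roundVar Δ lam x c = 0} = ∅ := by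
      ext c
      simp [roundVar, if_pos h, hx]
    rw [this, measureReal_empty]
    exact (Real.exp_pos _).le
  · have : {c | roundVar Δ lam x c = 0} =
        {c : unitInterval | (c : ℝ) < x * (lam * Real.log ((Δ : ℝ) + 1))}ᶜ := by
      ext c
      simp [roundVar, if_neg h]
    rw [this, measureReal_compl (measurableSet_lt measurable_subtype_coe measurable_const),
      volume_coe_lt (mul_nonneg h0 hL) (not_le.1 h).le]
    have := Real.add_one_le_exp (-(x * (lam * Real.log ((Δ : ℝ) + 1))))
    simp only [probReal_univ]
    linarith

/-- Any quantity that depends on the rounded set alone is a measurable function of the coins. -/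
theorem measurable_comp_roundedDS (x : V → ℝ) (φ : Finset V → ℝ) :
    Measurable fun c => φ (roundedDS G Δ lam x c) := by
  classical
  have h1 : Measurable fun (c : V → unitInterval) v => roundVar Δ lam (x v) (c v) :=
    measurable_pi_lambda _ fun v => (measurable_roundVar (x v)).comp (measurable_pi_apply v)
  let f : (V → ℕ) → ℝ := fun y =>
    φ (Finset.univ.filter fun v => 1 ≤ y v + (1 - ∑ u ∈ closedNbr G v, y u))
  have h2 : (fun c => φ (roundedDS G Δ lam x c)) =
      f ∘ fun (c : V → unitInterval) v => roundVar Δ lam (x v) (c v) := by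
    funext c
    simp only [f, Function.comp_apply]
    congr 1
  rw [h2]
  exact (measurable_of_countable f).comp h1

theorem integrable_of_bounded {X : Type*} [MeasurableSpace X] {μ : Measure X} [IsFiniteMeasure μ]
    {f : X → ℝ} (hf : Measurable f) {b : ℝ} (h0 : ∀ x, 0 ≤ f x) (hb : ∀ x, f x ≤ b) :
    Integrable f μ :=
  Integrable.of_bound hf.aestronglyMeasurable b
    (.of_forall fun x => by rw [Real.norm_of_nonneg (h0 x)]; exact hb x)

/-- Rounding costs a factor of `lam * log (Δ + 1)`, and the inequality of a node stays violated
with probability at most `1 / (Δ + 1)`. -/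
theorem integral_card_roundedDS_le {x : V → ℝ} (h0 : ∀ v, 0 ≤ x v) (h1 : ∀ v, x v ≤ 1)
    (hcov : ∀ v, 1 ≤ ∑ u ∈ closedNbr G v, x u) (hlam : 1 ≤ lam) :
    ∫ c, ((roundedDS G Δ lam x c).card : ℝ) ≤
      lam * Real.log ((Δ : ℝ) + 1) * ∑ v, x v + Fintype.card V / ((Δ : ℝ) + 1) := by
  classical
  have hΔ : (0 : ℝ) ≤ Δ := Nat.cast_nonneg Δ
  have hlog : 0 ≤ Real.log ((Δ : ℝ) + 1) := Real.log_nonneg (by linarith)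
  set L := lam * Real.log ((Δ : ℝ) + 1)
  have hL : 0 ≤ L := mul_nonneg (by linarith) hlog
  let A : V → Set (V → unitInterval) := fun v =>
    Set.univ.pi fun u => if u ∈ closedNbr G v then {c | roundVar Δ lam (x u) c = 0} else Set.univ
  have hA : ∀ v c, c ∈ A v ↔ ∀ u ∈ closedNbr G v, roundVar Δ lam (x u) (c u) = 0 := by
    intro v c
    simp only [A, Set.mem_pi, Set.mem_univ, true_implies]
    refine forall_congr' fun u => ?_
    split_ifs with h <;> simp [h]
  have hAm : ∀ v, MeasurableSet (A v) := fun v => MeasurableSet.univ_pi fun u => by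
    split_ifs
    · exact measurable_roundVar (x u) (measurableSet_singleton 0)
    · exact .univ
  have hAvol : ∀ v, volume.real (A v) ≤ 1 / ((Δ : ℝ) + 1) := by
    intro v
    rw [measureReal_def, volume_pi_pi, ENNReal.toReal_prod]
    calc ∏ u, (volume (if u ∈ closedNbr G v then {c | roundVar Δ lam (x u) c = 0}
          else Set.univ)).toReal
        = ∏ u ∈ closedNbr G v, volume.real {c | roundVar Δ lam (x u) c = 0} := by
          rw [← Finset.prod_subset (Finset.subset_univ (closedNbr G v))]
          · refine Finset.prod_congr rfl fun u hu => ?_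
            rw [if_pos hu, measureReal_def]
          · intro u _ hu
            rw [if_neg hu]
            simp
      _ ≤ ∏ u ∈ closedNbr G v, Real.exp (-(x u * L)) :=
          Finset.prod_le_prod (fun _ _ => measureReal_nonneg)
            fun u _ => volume_roundVar_eq_zero_le (h0 u) hL
      _ = Real.exp (-((∑ u ∈ closedNbr G v, x u) * L)) := by
          rw [← Real.exp_sum, Finset.sum_neg_distrib, Finset.sum_mul]
      _ ≤ Real.exp (-Real.log ((Δ : ℝ) + 1)) := by
          refine Real.exp_le_exp.2 (neg_le_neg ?_)
          calc Real.log ((Δ : ℝ) + 1) ≤ L := le_mul_of_one_le_left hlog hlam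
            _ ≤ _ := le_mul_of_one_le_left hL (hcov v)
      _ = _ := by rw [Real.exp_neg, Real.exp_log (by linarith), one_div]
  have hrm : ∀ v, Measurable fun c : V → unitInterval => (roundVar Δ lam (x v) (c v) : ℝ) :=
    fun v => (measurable_of_countable (fun m : ℕ => (m : ℝ))).comp
      ((measurable_roundVar (x v)).comp (measurable_pi_apply v))
  have hri : ∀ v, Integrable fun c : V → unitInterval => (roundVar Δ lam (x v) (c v) : ℝ) :=
    fun v => integrable_of_bounded (hrm v) (b := 1) (fun c => Nat.cast_nonneg _)
      fun c => by exact_mod_cast roundVar_le_one (h1 v) _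
  have hAi : ∀ v, Integrable ((A v).indicator fun _ => (1 : ℝ)) := fun v =>
    (integrable_const _).indicator (hAm v)
  have hpoint : ∀ c, ((roundedDS G Δ lam x c).card : ℝ) ≤
      ∑ v, (roundVar Δ lam (x v) (c v) : ℝ) + ∑ v, (A v).indicator (fun _ => (1 : ℝ)) c := by
    intro c
    rw [← Finset.sum_add_distrib, Finset.card_eq_sum_ones, Nat.cast_sum, Nat.cast_one,
      ← Finset.sum_filter_add_sum_filter_not Finset.univ (· ∈ roundedDS G Δ lam x c)]
    refine le_add_of_le_of_nonneg ?_ (Finset.sum_nonneg fun v _ =>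
      add_nonneg (Nat.cast_nonneg _) (Set.indicator_nonneg (fun _ _ => zero_le_one) _))
    rw [Finset.filter_mem_eq_inter, Finset.univ_inter]
    refine Finset.sum_le_sum fun v hv => ?_
    rw [mem_roundedDS, intDS] at hv
    by_cases hc : c ∈ A v
    · rw [Set.indicator_of_mem hc]
      exact le_add_of_nonneg_left (Nat.cast_nonneg _)
    · rw [Set.indicator_of_notMem hc, add_zero]
      have : ∑ u ∈ closedNbr G v, roundVar Δ lam (x u) (c u) ≠ 0 := fun hs =>
        hc ((hA v c).2 fun u hu => (Finset.sum_eq_zero_iff.1 hs) u hu)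
      exact_mod_cast (by omega : 1 ≤ roundVar Δ lam (x v) (c v))
  calc ∫ c, ((roundedDS G Δ lam x c).card : ℝ)
      ≤ ∫ c, (∑ v, (roundVar Δ lam (x v) (c v) : ℝ) +
          ∑ v, (A v).indicator (fun _ => (1 : ℝ)) c) :=
        integral_mono_of_nonneg (.of_forall fun c => Nat.cast_nonneg _)
          ((integrable_finsetSum _ fun v _ => hri v).add
            (integrable_finsetSum _ fun v _ => hAi v)) (.of_forall hpoint)
    _ = (∑ v, ∫ c : V → unitInterval, (roundVar Δ lam (x v) (c v) : ℝ)) +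
          ∑ v, ∫ c, (A v).indicator (fun _ => (1 : ℝ)) c := by
        rw [integral_add (integrable_finsetSum _ fun v _ => hri v)
          (integrable_finsetSum _ fun v _ => hAi v),
          integral_finsetSum _ fun v _ => hri v, integral_finsetSum _ fun v _ => hAi v]
    _ ≤ ∑ v, x v * L + ∑ _v : V, 1 / ((Δ : ℝ) + 1) := by
        refine add_le_add (Finset.sum_le_sum fun v _ => ?_) (Finset.sum_le_sum fun v _ => ?_)
        · have := integral_comp_eval (μ := fun _ : V => (volume : Measure unitInterval)) (i := v)
            (f := fun c => (roundVar Δ lam (x v) c : ℝ)) ((measurable_of_countable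
              fun m : ℕ => (m : ℝ)).comp (measurable_roundVar (x v))).aestronglyMeasurable
          exact this.trans_le (integral_roundVar_le (h0 v) (h1 v) hL)
        · rw [integral_indicator (hAm v)]
          simpa using hAvol v
    _ = _ := by
        rw [← Finset.sum_mul, mul_comm, Finset.sum_const, nsmul_eq_mul, Finset.card_univ,
          mul_one_div]

end rounding

/-! ### The expected size of the result -/

section expectation

variable {V : Type*} [Fintype V] {G : SimpleGraph V} {ident : V → ℕ} {n Δ k ℓ : ℕ} {α lam : ℝ}

/-- The rounded set as a function of the regrouped random choices. -/
noncomputable def roundedOf (G : SimpleGraph V) (ident : V → ℕ) (n Δ k : ℕ) (α lam : ℝ)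
    (ω : (Fin ℓ → V → unitInterval) × (V → unitInterval)) : Finset V :=
  roundedDS G Δ lam (fracDS G ident fun t v => radius n k α (ω.1 t v)) ω.2

/-- The radii take countably many values; given the radii, the coins are compared to constants. -/
theorem measurable_comp_roundedOf (φ : Finset V → ℝ) :
    Measurable fun ω : (Fin ℓ → V → unitInterval) × (V → unitInterval) =>
      φ (roundedOf G ident n Δ k α lam ω) := by
  let f : (Fin ℓ → V → ℕ) × (V → unitInterval) → ℝ := fun p =>
    φ (roundedDS G Δ lam (fracDS G ident p.1) p.2)
  have hf : Measurable f := by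
    refine measurable_from_prod_countable_right fun r => ?_
    exact measurable_comp_roundedDS (fracDS G ident r) φ
  have hr : Measurable fun (R : Fin ℓ → V → unitInterval) t v => radius n k α (R t v) :=
    measurable_pi_lambda _ fun t => measurable_pi_lambda _ fun v =>
      measurable_radius.comp ((measurable_pi_apply v).comp (measurable_pi_apply t))
  have hp : Measurable fun ω : (Fin ℓ → V → unitInterval) × (V → unitInterval) =>
      ((fun t v => radius n k α (ω.1 t v)), ω.2) :=
    (hr.comp measurable_fst).prodMk measurable_snd
  have he : (fun ω : (Fin ℓ → V → unitInterval) × (V → unitInterval) =>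
      φ (roundedOf G ident n Δ k α lam ω)) =
      f ∘ fun ω => ((fun t v => radius n k α (ω.1 t v)), ω.2) := by
    funext ω
    simp only [f, Function.comp_apply, roundedOf]
  rw [he]
  exact hf.comp hp

theorem card_le_mul_of_isDominating [DecidableRel G.Adj] {S : Finset V} (hS : IsDominating G S) :
    Fintype.card V ≤ S.card * (G.maxDegree + 1) := by
  classical
  have hsub : (Finset.univ : Finset V) ⊆ S.biUnion fun u => insert u (G.neighborFinset u) := by
    intro v _
    obtain ⟨u, hu, h⟩ := hS v
    refine Finset.mem_biUnion.2 ⟨u, hu, ?_⟩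
    rw [Finset.mem_insert, SimpleGraph.mem_neighborFinset]
    exact h.imp Eq.symm SimpleGraph.Adj.symm
  refine (Finset.card_le_card hsub).trans (Finset.card_biUnion_le_card_mul _ _ _ fun u _ => ?_)
  refine (Finset.card_insert_le _ _).trans (Nat.add_le_add_right ?_ 1)
  rw [SimpleGraph.card_neighborFinset_eq_degree]
  exact G.degree_le_maxDegree u

/-- Outcomes of the radii for which some node joins clusters in too few instances. -/
def fewClusters (G : SimpleGraph V) (ident : V → ℕ) (n k ℓ : ℕ) (α b : ℝ) :
    Set (Fin ℓ → V → unitInterval) :=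
  {R | ∃ j, (clusterCount G ident (fun t v => radius n k α (R t v)) j : ℝ) < b}

theorem measurable_radii {V : Type*} {n k : ℕ} {α : ℝ} :
    Measurable fun (u : V → unitInterval) v => radius n k α (u v) :=
  measurable_pi_lambda _ fun v => measurable_radius.comp (measurable_pi_apply v)

theorem measurableSet_clustered (j : V) : MeasurableSet {u : V → unitInterval |
    ∃ y, j ∈ lsCluster (lsGraph G) ident (fun v => radius n k α (u v)) y} :=
  measurable_radii (n := n) (k := k) (α := α)
    (show MeasurableSet {r : V → ℕ | ∃ y, j ∈ lsCluster (lsGraph G) ident r y} from .of_discrete)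

theorem measurableSet_fewClusters (b : ℝ) : MeasurableSet (fewClusters G ident n k ℓ α b) := by
  have hr : Measurable fun (R : Fin ℓ → V → unitInterval) t v => radius n k α (R t v) :=
    measurable_pi_lambda _ fun t => measurable_radii.comp (measurable_pi_apply t)
  exact hr (show MeasurableSet {r : Fin ℓ → V → ℕ | ∃ j, (clusterCount G ident r j : ℝ) < b}
    from .of_discrete)

/-- With `q = p * (1 - n * p ^ k)`, all nodes are clustered in at least `(1 - ε) * q * ℓ` instances,
except with a probability that Chernoff's bound and a union bound control. -/
theorem volume_fewClusters_le (hinj : Function.Injective ident) (hn : Fintype.card V = n)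
    (hn1 : 1 ≤ n) (hα : 0 ≤ α) {q ε : ℝ} (hq0 : 0 ≤ q)
    (hq : q = (n : ℝ) ^ (-α / (k : ℝ)) * (1 - n * ((n : ℝ) ^ (-α / (k : ℝ))) ^ k))
    (hε : 0 ≤ ε) :
    volume.real (fewClusters G ident n k ℓ α ((1 - ε) * (q * ℓ))) ≤
      n * Real.exp (-(ε ^ 2 * (q * ℓ)) / 2) := by
  classical
  let E : V → Set (V → unitInterval) := fun j =>
    {u | ∃ y, j ∈ lsCluster (lsGraph G) ident (fun v => radius n k α (u v)) y}
  have hE : ∀ j, q ≤ volume.real (E j) := by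
    intro j
    have := le_volume_clustered (lsGraph G) hinj (measurable_radius (n := n) (k := k) (α := α))
      (radius_le n k α) (decay_mem_Icc hn1 hα).1 (fun j hj => volume_le_radius hn1 hα hj) j
    rwa [hn, ← hq] at this
  have hEm : ∀ j, MeasurableSet (E j) := fun j => measurableSet_clustered j
  let B : V → Set (Fin ℓ → V → unitInterval) := fun j =>
    {R | (clusterCount G ident (fun t v => radius n k α (R t v)) j : ℝ) < (1 - ε) * (q * ℓ)}
  have hB : ∀ j, volume.real (B j) ≤ Real.exp (-(ε ^ 2 * (q * ℓ)) / 2) := by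
    intro j
    refine (measureReal_mono (fun R hR => ?_) (measure_ne_top _ _)).trans
      (volume_few_successes_le (hEm j) hq0 (hE j) hε ℓ)
    have hR' : (clusterCount G ident (fun t v => radius n k α (R t v)) j : ℝ) <
      (1 - ε) * (q * ℓ) := hR
    rw [clusterCount] at hR'
    refine lt_of_le_of_lt (Nat.cast_le.2 (Finset.card_le_card fun t ht => ?_)) hR'
    rw [Finset.mem_filter] at ht ⊢
    exact ht
  have hsub : fewClusters G ident n k ℓ α ((1 - ε) * (q * ℓ)) ⊆ ⋃ j, B j := by
    rintro R ⟨j, hj⟩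
    exact Set.mem_iUnion.2 ⟨j, hj⟩
  calc _ ≤ _ := measureReal_mono hsub (measure_ne_top _ _)
    _ ≤ ∑ j, volume.real (B j) := measureReal_iUnion_fintype_le _
    _ ≤ ∑ _j : V, Real.exp (-(ε ^ 2 * (q * ℓ)) / 2) := Finset.sum_le_sum fun j _ => hB j
    _ = _ := by rw [Finset.sum_const, nsmul_eq_mul, Finset.card_univ, hn]

/-- The expected size of the rounded set: outside an event of probability at most `b`, all sums of
the unscaled fractional solution are at least `m`. -/
theorem integral_card_roundedOf_le [DecidableRel G.Adj] (hinj : Function.Injective ident)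
    (hΔ : G.maxDegree = Δ) {S : Finset V} (hS : IsDominating G S) (hlam : 1 ≤ lam) {m b : ℝ}
    (hm : 0 < m) (hb : volume.real (fewClusters G ident n k ℓ α m) ≤ b) :
    ∫ ω : (Fin ℓ → V → unitInterval) × (V → unitInterval),
        ((roundedOf G ident n Δ k α lam ω).card : ℝ) ≤
      Fintype.card V * b +
        (lam * Real.log ((Δ : ℝ) + 1) * (ℓ * S.card / m) + S.card) := by
  set g : (Fin ℓ → V → unitInterval) × (V → unitInterval) → ℝ := fun ω =>
    ((roundedOf G ident n Δ k α lam ω).card : ℝ)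
  have hgm : Measurable g := measurable_comp_roundedOf fun s => (s.card : ℝ)
  have hg0 : ∀ ω, 0 ≤ g ω := fun ω => Nat.cast_nonneg _
  have hgn : ∀ ω, g ω ≤ Fintype.card V := fun ω => Nat.cast_le.2 (Finset.card_le_univ _)
  have hgi : Integrable g (volume.prod volume) := integrable_of_bounded hgm hg0 hgn
  set M : ℝ := lam * Real.log ((Δ : ℝ) + 1) * (ℓ * S.card / m) + S.card
  set bad := fewClusters G ident n k ℓ α m with hbad
  have hlog : 0 ≤ Real.log ((Δ : ℝ) + 1) :=
    Real.log_nonneg (by linarith [Nat.cast_nonneg (α := ℝ) Δ])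
  have hM0 : 0 ≤ M := by positivity
  have hinner : ∀ R, ∫ c, g (R, c) ≤ bad.indicator (fun _ => (Fintype.card V : ℝ)) R + M := by
    intro R
    by_cases hR : R ∈ bad
    · rw [Set.indicator_of_mem hR]
      have : ∫ c, g (R, c) ≤ ∫ _ : V → unitInterval, (Fintype.card V : ℝ) :=
        integral_mono_of_nonneg (.of_forall fun c => hg0 _) (integrable_const _)
          (.of_forall fun c => hgn _)
      simp only [integral_const, probReal_univ, one_smul] at this
      linarith
    · rw [Set.indicator_of_notMem hR, zero_add]
      set r : Fin ℓ → V → ℕ := fun t v => radius n k α (R t v)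
      have hcount : ∀ j, m ≤ ∑ i ∈ closedNbr G j, lpSum G ident r i := fun j =>
        (not_lt.1 fun h => hR ⟨j, h⟩).trans (clusterCount_le_sum_lpSum hinj j)
      refine (integral_card_roundedDS_le fracDS_nonneg fracDS_le_one
        (one_le_sum_fracDS hm hcount) hlam).trans (add_le_add ?_ ?_)
      · refine mul_le_mul_of_nonneg_left ?_ (mul_nonneg (by linarith) hlog)
        calc ∑ v, fracDS G ident r v ≤ ∑ v, lpSum G ident r v / m :=
              Finset.sum_le_sum fun v _ => fracDS_le_div hm hcount v
          _ = (∑ v, lpSum G ident r v) / m := (Finset.sum_div _ _ _).symm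
          _ ≤ _ := div_le_div_of_nonneg_right (sum_lpSum_le hinj hS) hm.le
      · rw [div_le_iff₀ (by positivity)]
        have := card_le_mul_of_isDominating hS
        rw [hΔ] at this
        exact_mod_cast this
  calc ∫ ω, g ω = ∫ R, ∫ c, g (R, c) := integral_prod g hgi
    _ ≤ ∫ R, (bad.indicator (fun _ => (Fintype.card V : ℝ)) R + M) :=
        integral_mono_of_nonneg (.of_forall fun R => integral_nonneg fun c => hg0 _)
          (((integrable_const _).indicator (measurableSet_fewClusters m)).add
            (integrable_const _)) (.of_forall hinner)
    _ = Fintype.card V * volume.real bad + M := by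
        rw [integral_add ((integrable_const _).indicator (measurableSet_fewClusters m))
          (integrable_const _), integral_indicator (measurableSet_fewClusters m)]
        simp [mul_comm, hbad]
    _ ≤ _ := by
        have := mul_le_mul_of_nonneg_left hb (Nat.cast_nonneg (α := ℝ) (Fintype.card V))
        linarith

theorem integrable_card_mcds :
    Integrable fun ω : V → Seed ℓ => ((mcds G ident n Δ k ℓ α lam ω).card : ℝ) := by
  have hm := (measurable_comp_roundedOf (G := G) (ident := ident) (n := n) (Δ := Δ) (k := k)
    (ℓ := ℓ) (α := α) (lam := lam) fun s => ((connectDS G ident k s).card : ℝ)).comp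
    (measurePreserving_regroup (V := V) (ℓ := ℓ)).measurable
  exact integrable_of_bounded (b := Fintype.card V) hm (fun _ => Nat.cast_nonneg _)
    fun ω => Nat.cast_le.2 (Finset.card_le_univ _)

theorem integral_card_mcds_le (hinj : Function.Injective ident) (hk : 1 ≤ k)
    (hn : Fintype.card V = n) :
    ∫ ω : V → Seed ℓ, ((mcds G ident n Δ k ℓ α lam ω).card : ℝ) ≤
      (1 + 8 * ((n : ℝ) ^ ((1 : ℝ) / k) + 1)) *
        ∫ ω : (Fin ℓ → V → unitInterval) × (V → unitInterval),
          ((roundedOf G ident n Δ k α lam ω).card : ℝ) := by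
  have hm : Measurable fun ω : (Fin ℓ → V → unitInterval) × (V → unitInterval) =>
      ((roundedOf G ident n Δ k α lam ω).card : ℝ) :=
    measurable_comp_roundedOf fun s => (s.card : ℝ)
  have hint : Integrable fun ω : (Fin ℓ → V → unitInterval) × (V → unitInterval) =>
      ((roundedOf G ident n Δ k α lam ω).card : ℝ) :=
    integrable_of_bounded (b := Fintype.card V) hm (fun _ => Nat.cast_nonneg _)
      fun ω => Nat.cast_le.2 (Finset.card_le_univ _)
  have hint' := measurePreserving_regroup.integrable_comp_of_integrable hint
  rw [← measurePreserving_regroup.map_eq, integral_map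
    measurePreserving_regroup.measurable.aemeasurable hm.aestronglyMeasurable,
    ← integral_const_mul]
  exact integral_mono integrable_card_mcds (hint'.const_mul _)
    fun ω => card_connectDS_le hinj hk hn _

theorem exists_isCDS_card_eq_cdsOpt {V : Type*} {G : SimpleGraph V} {S : Finset V}
    (hS : IsCDS G S) : ∃ S : Finset V, IsCDS G S ∧ S.card = cdsOpt G :=
  Nat.sInf_mem (s := {m | ∃ S : Finset V, IsCDS G S ∧ S.card = m}) ⟨_, S, hS, rfl⟩

theorem mul_decay_pow (hn : 1 ≤ n) (hk : 1 ≤ k) :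
    (n : ℝ) * ((n : ℝ) ^ (-α / (k : ℝ))) ^ k = (n : ℝ) ^ (1 - α) := by
  have hn0 : (0 : ℝ) < n := by exact_mod_cast hn
  have hk0 : (k : ℝ) ≠ 0 := by exact_mod_cast (by omega : k ≠ 0)
  rw [← Real.rpow_natCast, ← Real.rpow_mul hn0.le, div_mul_cancel₀ _ hk0, sub_eq_add_neg,
    Real.rpow_add hn0, Real.rpow_one]

theorem log_add_one_le_two_mul_log (hΔ : 2 ≤ Δ) :
    Real.log ((Δ : ℝ) + 1) ≤ 2 * Real.log Δ ∧ 1 ≤ 2 * Real.log Δ := by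
  have hΔR : (2 : ℝ) ≤ Δ := by exact_mod_cast hΔ
  constructor
  · have h1 : Real.log ((Δ : ℝ) + 1) ≤ Real.log ((Δ : ℝ) * Δ) :=
      Real.log_le_log (by linarith) (by nlinarith)
    rw [Real.log_mul (by linarith) (by linarith)] at h1
    linarith
  · have h1 := Real.log_two_gt_d9
    have h2 := Real.log_le_log (by norm_num) hΔR
    linarith

/-- The success probability `q` of the clustering is positive and of order `n ^ (-α / k)`. -/
theorem success_probability_bounds (hn : 2 ≤ n) (hk : 1 ≤ k) (hα : 1 < α) {q : ℝ}
    (hq : q = (n : ℝ) ^ (-α / (k : ℝ)) * (1 - n * ((n : ℝ) ^ (-α / (k : ℝ))) ^ k)) :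
    0 < 1 - (2 : ℝ) ^ (1 - α) ∧ 0 < q ∧
      1 - (2 : ℝ) ^ (1 - α) ≤ (n : ℝ) ^ (α / (k : ℝ)) * q := by
  have hn0 : (0 : ℝ) < n := by exact_mod_cast (by omega : 0 < n)
  have hκ0 : 0 < 1 - (2 : ℝ) ^ (1 - α) := by
    have : (2 : ℝ) ^ (1 - α) < 1 := Real.rpow_lt_one_of_one_lt_of_neg (by norm_num) (by linarith)
    linarith
  have hκ : (n : ℝ) ^ (1 - α) ≤ 2 ^ (1 - α) :=
    Real.rpow_le_rpow_of_nonpos (by norm_num) (by exact_mod_cast hn) (by linarith)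
  rw [mul_decay_pow (by omega) hk] at hq
  refine ⟨hκ0, hq ▸ mul_pos (Real.rpow_pos_of_pos hn0 _) (by linarith), ?_⟩
  rw [hq, ← mul_assoc, ← Real.rpow_add hn0, neg_div, add_neg_cancel, Real.rpow_zero, one_mul]
  linarith

/-- The choice of `ℓ` makes the probability of a bad clustering at most `n⁻²`, and the rounded set
has at most `n` nodes, so bad outcomes contribute at most `1`. -/
theorem integral_card_roundedOf_le_card [DecidableRel G.Adj] {ε β q : ℝ} (hα : 1 < α)
    (hε₀ : 0 < ε) (hε₁ : ε < 1) (hβ : 1 ≤ β) (hlam : 1 ≤ lam) (hk : 1 ≤ k) (hn2 : 2 ≤ n)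
    (hq : q = (n : ℝ) ^ (-α / (k : ℝ)) * (1 - n * ((n : ℝ) ^ (-α / (k : ℝ))) ^ k))
    (hℓ : 2 * (1 + β) / (ε ^ 2 * q) * Real.log n ≤ ℓ)
    (hinj : Function.Injective ident) (hn : Fintype.card V = n)
    (hΔ : G.maxDegree = Δ) {S : Finset V} (hS : IsDominating G S) :
    ∫ ω : (Fin ℓ → V → unitInterval) × (V → unitInterval),
      ((roundedOf G ident n Δ k α lam ω).card : ℝ) ≤
      1 + (lam * Real.log ((Δ : ℝ) + 1) *
        ((n : ℝ) ^ (α / (k : ℝ)) * S.card / ((1 - ε) * (1 - 2 ^ (1 - α)))) + S.card) := by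
  have hnR : (2 : ℝ) ≤ n := by exact_mod_cast hn2
  have hn0 : (0 : ℝ) < n := by linarith
  obtain ⟨hκ0, hq0, hκq⟩ := success_probability_bounds hn2 hk hα hq
  set κ : ℝ := 1 - 2 ^ (1 - α)
  set a : ℝ := (n : ℝ) ^ (α / (k : ℝ))
  have hlogn : 0 < Real.log n := Real.log_pos (by linarith)
  have hℓq : 2 * (1 + β) * Real.log n ≤ ε ^ 2 * (q * ℓ) := by
    rw [div_mul_eq_mul_div, div_le_iff₀ (by positivity)] at hℓ
    linarith
  have hqℓ : 0 < q * ℓ := by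
    have h1 : 0 < ε ^ 2 * (q * ℓ) := lt_of_lt_of_le (by positivity) hℓq
    exact pos_of_mul_pos_right h1 (by positivity)
  have hℓ0 : (0 : ℝ) < ℓ := pos_of_mul_pos_right hqℓ hq0.le
  have h1ε : 0 < 1 - ε := by linarith
  have hbad := volume_fewClusters_le (G := G) (ident := ident) (k := k) (ℓ := ℓ) (α := α)
    hinj hn (by omega) (by linarith) hq0.le hq hε₀.le
  have hE := integral_card_roundedOf_le (n := n) (k := k) (lam := lam) hinj hΔ hS hlam
    (mul_pos h1ε hqℓ) hbad
  rw [hn] at hE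
  have hexp : Real.exp (-(ε ^ 2 * (q * ℓ)) / 2) ≤ 1 / ((n : ℝ) * n) := by
    calc _ ≤ Real.exp (-(Real.log n + Real.log n)) := Real.exp_le_exp.2 (by nlinarith)
      _ = _ := by rw [Real.exp_neg, Real.exp_add, Real.exp_log hn0, one_div]
  have hbad1 : (n : ℝ) * (n * Real.exp (-(ε ^ 2 * (q * ℓ)) / 2)) ≤ 1 := by
    calc _ = (n * n : ℝ) * Real.exp (-(ε ^ 2 * (q * ℓ)) / 2) := by ring
      _ ≤ (n * n : ℝ) * (1 / ((n : ℝ) * n)) := mul_le_mul_of_nonneg_left hexp (by positivity)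
      _ = 1 := mul_one_div_cancel (by positivity)
  have hqinv : (ℓ : ℝ) * S.card / ((1 - ε) * (q * ℓ)) ≤ a * S.card / ((1 - ε) * κ) := by
    rw [div_le_div_iff₀ (mul_pos h1ε hqℓ) (mul_pos h1ε hκ0)]
    calc (ℓ : ℝ) * S.card * ((1 - ε) * κ) = ℓ * S.card * (1 - ε) * κ := by ring
      _ ≤ ℓ * S.card * (1 - ε) * (a * q) := mul_le_mul_of_nonneg_left hκq (by positivity)
      _ = _ := by ring
  have hlog : 0 ≤ lam * Real.log ((Δ : ℝ) + 1) := mul_nonneg (by linarith)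
    (Real.log_nonneg (by linarith [Nat.cast_nonneg (α := ℝ) Δ]))
  have := mul_le_mul_of_nonneg_left hqinv hlog
  linarith

/-- The bound on the expected size, with an explicit constant. -/
theorem integral_card_mcds_le_cdsOpt [DecidableRel G.Adj] {ε β : ℝ} (hα : 1 < α) (hε₀ : 0 < ε)
    (hε₁ : ε < 1) (hβ : 1 ≤ β) (hlam : 1 ≤ lam) (hk : 1 ≤ k)
    (hℓ : 2 * (1 + β) / (ε ^ 2 * ((n : ℝ) ^ (-α / (k : ℝ)) *
      (1 - (n : ℝ) * ((n : ℝ) ^ (-α / (k : ℝ))) ^ k))) * Real.log n ≤ ℓ)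
    (hG : G.Connected) (hinj : Function.Injective ident) (hn : Fintype.card V = n)
    (hΔ : G.maxDegree = Δ) (hΔ2 : 2 ≤ Δ) :
    ∫ ω : V → Seed ℓ, ((mcds G ident n Δ k ℓ α lam ω).card : ℝ) ≤
      17 * (4 + 2 * lam / ((1 - ε) * (1 - 2 ^ (1 - α)))) * cdsOpt G *
        (n : ℝ) ^ ((α + 1) / (k : ℝ)) * Real.log Δ := by
  obtain ⟨S, hS, hScard⟩ := exists_isCDS_card_eq_cdsOpt
    (isCDS_connectDS hinj k hG (isDominating_roundedDS Δ lam 0 0))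
  have hne := hG.nonempty
  -- `n` exceeds the maximum degree
  have hn3 : 3 ≤ n := by
    have := G.maxDegree_lt_card_verts
    omega
  have hnR : (3 : ℝ) ≤ n := by exact_mod_cast hn3
  have hn0 : (0 : ℝ) < n := by linarith
  have hED := integral_card_roundedOf_le_card hα hε₀ hε₁ hβ hlam hk (by omega) rfl hℓ hinj hn hΔ
    hS.1
  have hmain := integral_card_mcds_le (G := G) (Δ := Δ) (ℓ := ℓ) (α := α) (lam := lam) hinj hk hn
  set I := ∫ ω : (Fin ℓ → V → unitInterval) × (V → unitInterval),
      ((roundedOf G ident n Δ k α lam ω).card : ℝ)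
  have hI0 : 0 ≤ I := integral_nonneg fun ω => Nat.cast_nonneg _
  have hκ0 := (success_probability_bounds (n := n) (k := k) (by omega) hk hα rfl).1
  have hS1 : (1 : ℝ) ≤ S.card := by
    obtain ⟨u, hu, -⟩ := hS.1 (Classical.arbitrary V)
    exact_mod_cast Finset.card_pos.2 ⟨u, hu⟩
  obtain ⟨hlogΔ1, hlogΔ⟩ := log_add_one_le_two_mul_log hΔ2
  set b : ℝ := (1 - ε) * (1 - 2 ^ (1 - α)) with hb
  have hb0 : 0 < b := mul_pos (by linarith) hκ0
  set a : ℝ := (n : ℝ) ^ (α / (k : ℝ)) with ha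
  have ha1 : 1 ≤ a := Real.one_le_rpow (by linarith) (by positivity)
  set e : ℝ := (n : ℝ) ^ ((1 : ℝ) / k) with he
  have he1 : 1 ≤ e := Real.one_le_rpow (by linarith) (by positivity)
  have hae : (n : ℝ) ^ ((α + 1) / (k : ℝ)) = a * e := by
    rw [he, ha, ← Real.rpow_add hn0, add_div]
  have hIb : I ≤ (4 + 2 * lam / b) * S.card * a * Real.log Δ := by
    have h1 : lam * Real.log ((Δ : ℝ) + 1) * (a * S.card / b) ≤
        lam * (2 * Real.log Δ) * (a * S.card / b) :=
      mul_le_mul_of_nonneg_right (mul_le_mul_of_nonneg_left hlogΔ1 (by linarith)) (by positivity)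
    have h3 : 1 ≤ 2 * Real.log Δ * a := one_le_mul_of_one_le_of_one_le hlogΔ ha1
    have h2 : (2 : ℝ) * S.card * 1 ≤ 2 * S.card * (2 * Real.log Δ * a) :=
      mul_le_mul_of_nonneg_left h3 (by linarith)
    calc I ≤ 2 * S.card * (2 * Real.log Δ * a) + lam * (2 * Real.log Δ) * (a * S.card / b) := by
          linarith
      _ = _ := by ring
  have hprod : (1 + 8 * (e + 1)) * I ≤
      17 * e * ((4 + 2 * lam / b) * S.card * a * Real.log Δ) :=
    mul_le_mul (by linarith) hIb hI0 (by linarith)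
  refine hmain.trans (hprod.trans_eq ?_)
  rw [hae, ← hScard]
  ring

end expectation

end DistCDS

theorem mainTheorem9 (α ε β lam : ℝ) (hα : 1 < α) (hε₀ : 0 < ε) (hε₁ : ε < 1) (hβ : 1 ≤ β)
    (hlam : 2 + Real.sqrt 3 ≤ lam) :
    ∃ C : ℕ, ∀ k n Δ ℓ : ℕ, 1 ≤ k →
      2 * (1 + β) /
        (ε ^ 2 * ((n : ℝ) ^ (-α / (k : ℝ)) * (1 - (n : ℝ) * ((n : ℝ) ^ (-α / (k : ℝ))) ^ k)))
          * Real.log n ≤ ℓ →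
      ∃ (A : DistCDS.LocalAlg (DistCDS.Seed ℓ) Bool) (T : ℕ), T ≤ C * k ∧
        ∀ (V : Type*) [Fintype V] (G : SimpleGraph V) [DecidableRel G.Adj] (ident : V → ℕ),
          G.Connected → Function.Injective ident → Fintype.card V = n → G.maxDegree = Δ →
          (∀ (port : V → V → ℕ), DistCDS.IsPortNumbering G port →
            ∀ ω : V → DistCDS.Seed ℓ,
              A.outputSet G ident port ω T = DistCDS.mcds G ident n Δ k ℓ α lam ω) ∧
          (∀ ω : V → DistCDS.Seed ℓ, DistCDS.IsCDS G (DistCDS.mcds G ident n Δ k ℓ α lam ω)) ∧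
          (2 ≤ Δ →
            MeasureTheory.Integrable
              (fun ω : V → DistCDS.Seed ℓ =>
                ((DistCDS.mcds G ident n Δ k ℓ α lam ω).card : ℝ)) MeasureTheory.volume ∧
            (∫ ω : V → DistCDS.Seed ℓ, ((DistCDS.mcds G ident n Δ k ℓ α lam ω).card : ℝ)) ≤
              C * (DistCDS.cdsOpt G : ℝ) * (n : ℝ) ^ ((C : ℝ) / (k : ℝ)) * Real.log Δ) := by
  set c : ℝ := 17 * (4 + 2 * lam / ((1 - ε) * (1 - 2 ^ (1 - α)))) with hc
  -- the constant serves as the factor of the round count, as the factor `c` and as the exponent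
  refine ⟨22 + ⌈c⌉₊ + ⌈α + 1⌉₊, fun k n Δ ℓ hk hℓ => ?_⟩
  obtain ⟨A, hA⟩ := DistCDS.exists_localAlg_mcds n Δ ℓ α lam hk
  refine ⟨A, 22 * k, Nat.mul_le_mul_right k (by omega), ?_⟩
  intro V _ G _ ident hG hinj hn hΔ
  refine ⟨fun port hport ω => hA V G ident hinj port hport ω,
    fun ω => DistCDS.isCDS_connectDS hinj k hG (DistCDS.isDominating_roundedDS _ _ _ _),
    fun hΔ2 => ⟨DistCDS.integrable_card_mcds, ?_⟩⟩
  have hlam₁ : 1 ≤ lam := by linarith [Real.sqrt_nonneg 3]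
  refine (DistCDS.integral_card_mcds_le_cdsOpt hα hε₀ hε₁ hβ hlam₁ hk hℓ hG hinj hn hΔ hΔ2).trans ?_
  have hn₁ : (1 : ℝ) ≤ n := by
    have := hG.nonempty
    exact_mod_cast hn ▸ Fintype.card_pos (α := V)
  have hΔ₁ : (1 : ℝ) ≤ Δ := by exact_mod_cast one_le_two.trans hΔ2
  have hcC : c ≤ ((22 + ⌈c⌉₊ + ⌈α + 1⌉₊ : ℕ) : ℝ) :=
    (Nat.le_ceil c).trans (Nat.cast_le.2 (by omega))
  have hαC : α + 1 ≤ ((22 + ⌈c⌉₊ + ⌈α + 1⌉₊ : ℕ) : ℝ) :=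
    (Nat.le_ceil (α + 1)).trans (Nat.cast_le.2 (by omega))
  have hpow : (n : ℝ) ^ ((α + 1) / (k : ℝ)) ≤
      (n : ℝ) ^ (((22 + ⌈c⌉₊ + ⌈α + 1⌉₊ : ℕ) : ℝ) / (k : ℝ)) :=
    Real.rpow_le_rpow_of_exponent_le hn₁ (div_le_div_of_nonneg_right hαC (Nat.cast_nonneg k))
  rw [← hc]
  have := Real.log_nonneg hΔ₁
  gcongr
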